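/- Let $\beta>0$ and $K>0$. For $n\ge 1$ let $P_n$ be the product measure on $\{-1,0,1\}^n$ with one-dimensional marginals $\rho=\frac13(\delta_{-1}+\delta_0+\delta_1)$, let $$H_{n,K}(\omega)=\sum_{j=1}^n\omega_j^2-\frac Kn\Big(\sum_{j=1}^n\omega_j\Big)^2,$$ and let $P_{\beta,K,n}$ be the mean-field Blume–Emery–Griffiths (BEG) measure $$P_{\beta,K,n}(d\omega)=\frac1{Z_{\beta,K,n}}\,e^{-\beta H_{n,K}(\omega)}\,P_n(d\omega),$$ where $Z_{\beta,K,n}$ is the normalising constant. Let $S_n(\omega)=\sum_{j=1}^n\omega_j$ and, for $\gamma\in(0,1/2]$, let $W_\gamma=S_n/n^{1-\gamma}$, regarded as a random variable under $P_{\beta,K,n}$; $\mathbb E$ denotes expectation under $P_{\beta,K,n}$. Put $\beta_c=\log 4$ and $K_c(\beta)=\frac{e^\beta+2}{4\beta}$, and $$A=\{(\beta,K):0<\beta\le\beta_c,\ 0<K<K_c(\beta)\},\qquad B=\{(\beta,K):0<\beta<\beta_c,\ K=K_c(\beta)\}.$$ **Theorem 2.1.** 1. Let $(\beta,K)\in A$.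 There is a constant $L_1$ depending only on $(\beta,K)$ such that for all $n\ge1$, if $Z_A$ has the normal distribution $N(0,\mathbb E[W_{1/2}^2])$, then $$\sup_{t\in\mathbb R}\big|P(W_{1/2}\le t)-P(Z_A\le t)\big|\le L_1\,n^{-1/2}.$$ 2. Let $(\beta,K)\in B$, i.e. $0<\beta<\beta_c$ and $K=K_c(\beta)$. There is a constant $L_3$ depending only on $(\beta,K)$ such that for all $n\ge1$, if $Z_B$ has the probability density $f_B(t)=L_2\exp\!\big(-t^4/(4\,\mathbb E[W_{1/4}^4])\big)$ on $\mathbb R$, where $L_2$ (depending on $n$) is the normalisation constant, then $$\sup_{t\in\mathbb R}\big|P(W_{1/4}\le t)-P(Z_B\le t)\big|\le L_3\,n^{-1/4}.$$ 3. Let $(\beta,K)=(\beta_c,K_c(\beta_c))=(\log 4,\,3/(2\log 4))$ (the tricritical point $C$). There is a constant $L_5$ such that for all $n\ge1$, if $Z_C$ has the probability density $f_C(t)=L_4\exp\!\big(-t^6/(6\,\mathbb E[W_{1/6}^6])\big)$ on $\mathbb R$, where $L_4$ (depending on $n$) is the normalisation constant, then $$\sup_{t\in\mathbb R}\big|P(W_{1/6}\le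 t)-P(Z_C\le t)\big|\le L_5\,n^{-1/6}.$$ -/

import Mathlib

open MeasureTheory ProbabilityTheory

namespace BEG

noncomputable section

/-- The three spin values -1, 0, 1. -/
abbrev Spin : Type := ({-1, 0, 1} : Finset ℤ)

/-- The configuration space {-1, 0, 1}^n. -/
abbrev Config (n : ℕ) : Type := Fin n → Spin

/-- The real value of the spin at site `j`. -/
def spin {n : ℕ} (ω : Config n) (j : Fin n) : ℝ := ((ω j : ℤ) : ℝ)

/-- The single-site measure `ρ = (δ₋₁ + δ₀ + δ₁) / 3`. -/
def rho : Measure Spin :=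
  (3 : ENNReal)⁻¹ • (Measure.dirac ⟨-1, by decide⟩ + Measure.dirac ⟨0, by decide⟩ +
    Measure.dirac ⟨1, by decide⟩)

instance : IsProbabilityMeasure rho := by
  constructor
  simp only [rho, Measure.smul_apply, Measure.add_apply, measure_univ, smul_eq_mul]
  rw [one_add_one_eq_two, two_add_one_eq_three]
  exact ENNReal.inv_mul_cancel (by norm_num) (by norm_num)

/-- The product measure `P_n` on configurations with one-dimensional marginals `ρ`. -/
def productMeasure (n : ℕ) : Measure (Config n) := Measure.pi fun _ => rho

instance (n : ℕ) : IsProbabilityMeasure (productMeasure n) := by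
  unfold productMeasure; infer_instance

/-- The total spin `S_n(ω) = ∑ ω_j`. -/
def totalSpin {n : ℕ} (ω : Config n) : ℝ := ∑ j, spin ω j

/-- The Hamiltonian `H_{n,K}(ω) = ∑ ω_j² - (K/n) (∑ ω_j)²`. -/
def hamiltonian (n : ℕ) (K : ℝ) (ω : Config n) : ℝ :=
  ∑ j, spin ω j ^ 2 - K / n * totalSpin ω ^ 2

/-- The Gibbs measure `P_{β,K,n}(dω) = Z⁻¹ exp(-β H_{n,K}(ω)) P_n(dω)`; `Measure.tilted` is the
reweighting by `exp`, normalised by its integral. -/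
def gibbs (β K : ℝ) (n : ℕ) : Measure (Config n) :=
  (productMeasure n).tilted fun ω => -β * hamiltonian n K ω

instance (β K : ℝ) (n : ℕ) : IsProbabilityMeasure (gibbs β K n) :=
  isProbabilityMeasure_tilted Integrable.of_finite

/-- The rescaled total spin `W_γ = S_n / n^(1-γ)`. -/
def W (γ : ℝ) {n : ℕ} (ω : Config n) : ℝ := totalSpin ω / (n : ℝ) ^ (1 - γ)

/-- The moment `E(W_γ^k)` under the Gibbs measure. -/
def momentW (β K γ : ℝ) (n k : ℕ) : ℝ := ∫ ω, W γ ω ^ k ∂(gibbs β K n)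

/-- The distribution of `W_γ` under the Gibbs measure. -/
def lawW (β K γ : ℝ) (n : ℕ) : Measure ℝ := (gibbs β K n).map (W γ)

instance (β K γ : ℝ) (n : ℕ) : IsProbabilityMeasure (lawW β K γ n) :=
  Measure.isProbabilityMeasure_map (measurable_of_finite _).aemeasurable

/-- The probability measure on `ℝ` with Lebesgue density `t ↦ L · exp(-c t^k)`, where
`L = (∫ exp(-c t^k) dt)⁻¹` (meaningful for `0 < c` and even `k > 0`). -/
def expPowLaw (c : ℝ) (k : ℕ) : Measure ℝ := volume.tilted fun t => -c * t ^ k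

/-- The Kolmogorov distance `sup_t |μ(-∞, t] - ν(-∞, t]|`. -/
def kolmogorovDist (μ ν : Measure ℝ) : ℝ :=
  ⨆ t : ℝ, |μ.real (Set.Iic t) - ν.real (Set.Iic t)|

/-- The critical inverse temperature `β_c = log 4`. -/
def betaC : ℝ := Real.log 4

/-- The critical interaction strength `K_c(β) = (e^β + 2) / (4 β)`. -/
def critK (β : ℝ) : ℝ := (Real.exp β + 2) / (4 * β)

/-- The single-phase region `A`. -/
def regionA : Set (ℝ × ℝ) := {p | 0 < p.1 ∧ p.1 ≤ betaC ∧ 0 < p.2 ∧ p.2 < critK p.1}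

/-- The curve `B` of second-order points. -/
def curveB : Set (ℝ × ℝ) := {p | 0 < p.1 ∧ p.1 < betaC ∧ p.2 = critK p.1}

/-! Sanity facts: for `n ≥ 1` the comparison laws below are honest probability densities. -/

lemma isProbabilityMeasure_expPowLaw {c : ℝ} (hc : 0 < c) {k : ℕ} (hk : Even k) (hk0 : k ≠ 0) :
    IsProbabilityMeasure (expPowLaw c k) := by
  refine isProbabilityMeasure_tilted ?_
  have h2 : ∀ t : ℝ, t ^ 2 ≤ t ^ k + 1 := by
    intro t
    have h2k : 2 ≤ k := by
      obtain ⟨m, rfl⟩ := hk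
      omega
    rcases le_total |t| 1 with h | h
    · have : t ^ 2 ≤ 1 := by rw [← sq_abs]; exact pow_le_one₀ (abs_nonneg t) h
      have := hk.pow_nonneg t
      linarith
    · have := pow_le_pow_right₀ h h2k
      rw [sq_abs, hk.pow_abs] at this
      linarith
  refine ((integrable_exp_neg_mul_sq hc).const_mul (Real.exp c)).mono'
    (by fun_prop) (Filter.Eventually.of_forall fun t => ?_)
  rw [Real.norm_eq_abs, abs_of_pos (Real.exp_pos _), ← Real.exp_add]
  apply Real.exp_le_exp.mpr
  nlinarith [h2 t]

lemma momentW_pos (β K γ : ℝ) {n : ℕ} (hn : 1 ≤ n) {k : ℕ} (hk : Even k) :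
    0 < momentW β K γ n k := by
  have hf : ∀ x : Config n, 0 ≤ W γ x ^ k := fun x => hk.pow_nonneg _
  refine (integral_pos_iff_support_of_nonneg hf Integrable.of_finite).2 ?_
  let ω₁ : Config n := fun _ => ⟨1, by decide⟩
  have hn0 : (0 : ℝ) < n := by exact_mod_cast hn
  have hS : totalSpin ω₁ = n := by simp [totalSpin, spin, ω₁]
  have hmem : ω₁ ∈ Function.support fun x : Config n => W γ x ^ k := by
    have : 0 < W γ ω₁ := by
      rw [W, hS]
      positivity
    exact (pow_pos this k).ne'
  have hρ : rho {⟨1, by decide⟩} ≠ 0 := by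
    simp [rho]
  have hP : productMeasure n {ω₁} ≠ 0 := by
    rw [productMeasure, Measure.pi_singleton]
    exact Finset.prod_ne_zero_iff.2 fun _ _ => hρ
  have hac : productMeasure n ≪ gibbs β K n := absolutelyContinuous_tilted Integrable.of_finite
  have hG : gibbs β K n {ω₁} ≠ 0 := fun h => hP (hac h)
  exact (pos_iff_ne_zero.2 hG).trans_le (measure_mono (Set.singleton_subset_iff.2 hmem))

end

end BEG

open BEG

open MeasureTheory ProbabilityTheory
open Set Filter Topology

namespace BEG

/-! The proof is Stein's method driven by a leave-one-out identity in place of an exchangeable pair.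
Let `S` be the total spin, `S_j` the sum without site `j`, and `m_j` the conditional mean of spin
`j` given the others. Given the other spins, `ω_j - m_j` has mean zero, so `E[g(S)(S - ∑ m_j)] = ∑
E[(g(S) - g(S_j))(ω_j - m_j)]` for every test function `g` (`integral_mul_totalSpin_sub`). The right
side sees the derivative of `g` times a conditional variance close to a constant `v`. The left side
sees the mean-field force `S - ∑ m_j`, which is nearly `n (x - condMean A (b x))` at `x = S / n`,
with `A = e^(-β)` and `b = 2βK`.

The three regimes differ only in the order to which this force vanishes at `0`: it behaves like `a
x^(2k-1)` with `k = 1, 2, 3`. The Taylor coefficients of its numerator are explicit and all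
nonnegative (`IsCriticalOrder`), which gives both the local expansion and a lower bound on all of
`[-1, 1]`. With `r = n^(1/(2k))` and `W = S / r^(2k-1)`, taking `g` to be a rescaled `f` yields `v
E[f'(W)] = a E[W^(2k-1) f(W)] + O(1/r)` (`SiteBounds.exists_stein_identity`). This is the
approximate Stein identity of a density `exp(-c t^(2k))`. The choice `f(w) = w` shows that `a
E[W^(2k)]` is within `O(1/r)` of `v`, so `a / v` may be replaced by `1 / E[W^(2k)]`, the constant in
the theorem.

For the Kolmogorov distance, `f` solves the Stein equation of a half-line, and `f'` jumps at its
endpoint `z` (`exists_stein_solution`). The jump costs the probability that `S` lies in a window of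
bounded length. That probability is `O(1/r)` (`SiteBounds.exists_concentration`), by the same
identity applied to a clipped linear function. -/

/-- The unnormalised density `exp(-c t^(2k))`. -/
noncomputable def expPow (c : ℝ) (k : ℕ) (t : ℝ) : ℝ := Real.exp (-c * t ^ (2 * k))

/-- The mass of `expPow c k` to the left of `w`. -/
noncomputable def lowerTail (c : ℝ) (k : ℕ) (w : ℝ) : ℝ := ∫ t in Iic w, expPow c k t

/-- The mass of `expPow c k` to the right of `w`. -/
noncomputable def upperTail (c : ℝ) (k : ℕ) (w : ℝ) : ℝ := ∫ t in Ioi w, expPow c k t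

/-! ### Tails and Mills ratios of the density `exp(-c t^(2k))`. -/

section Tails

variable {c : ℝ} {k : ℕ}

lemma expPow_pos (c : ℝ) (k : ℕ) (t : ℝ) : 0 < expPow c k t := Real.exp_pos _

lemma expPow_neg (c : ℝ) (k : ℕ) (t : ℝ) : expPow c k (-t) = expPow c k t := by
  rw [expPow, expPow, (even_two_mul k).neg_pow]

lemma continuous_expPow (c : ℝ) (k : ℕ) : Continuous (expPow c k) := by
  unfold expPow; fun_prop

lemma integrable_expPow (hc : 0 < c) (hk : k ≠ 0) : Integrable (expPow c k) := by
  by_contra h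
  have hP := isProbabilityMeasure_expPowLaw hc (even_two_mul k) (by omega)
  -- Tilting by a non-integrable weight gives the zero measure by default, which is not a
  -- probability measure.
  have h0 : expPowLaw c (2 * k) = 0 := tilted_of_not_integrable h
  have := hP.measure_univ
  simp [h0] at this

lemma lowerTail_pos (hc : 0 < c) (hk : k ≠ 0) (w : ℝ) : 0 < lowerTail c k w := by
  refine (setIntegral_pos_iff_support_of_nonneg_ae (Eventually.of_forall fun t =>
    (expPow_pos c k t).le) (integrable_expPow hc hk).integrableOn).2 ?_
  have : Function.support (expPow c k) = univ := by
    ext t; simp [(expPow_pos c k t).ne']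
  rw [this, univ_inter]
  simp

lemma upperTail_eq_lowerTail_neg (c : ℝ) (k : ℕ) (w : ℝ) :
    upperTail c k w = lowerTail c k (-w) := by
  have := integral_comp_neg_Iic (-w) (expPow c k)
  simp only [expPow_neg, neg_neg] at this
  exact this.symm

lemma upperTail_pos (hc : 0 < c) (hk : k ≠ 0) (w : ℝ) : 0 < upperTail c k w := by
  rw [upperTail_eq_lowerTail_neg]; exact lowerTail_pos hc hk _

lemma lowerTail_add_upperTail (hc : 0 < c) (hk : k ≠ 0) (w : ℝ) :
    lowerTail c k w + upperTail c k w = ∫ t, expPow c k t := by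
  have := integral_add_compl (measurableSet_Iic (a := w)) (integrable_expPow hc hk)
  rwa [compl_Iic] at this

lemma lowerTail_mono (hc : 0 < c) (hk : k ≠ 0) : Monotone (lowerTail c k) := fun _ _ h =>
  setIntegral_mono_set (integrable_expPow hc hk).integrableOn
    (Eventually.of_forall fun t => (expPow_pos c k t).le)
    (Iic_subset_Iic.2 h).eventuallyLE

lemma hasDerivAt_lowerTail (hc : 0 < c) (hk : k ≠ 0) (w : ℝ) :
    HasDerivAt (lowerTail c k) (expPow c k w) w := by
  have hi := integrable_expPow hc hk
  have h : lowerTail c k = fun u => lowerTail c k 0 + ∫ t in (0 : ℝ)..u, expPow c k t := by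
    funext u
    rw [← intervalIntegral.integral_Iic_sub_Iic hi.integrableOn hi.integrableOn]
    simp [lowerTail]
  rw [h]
  exact ((continuous_expPow c k).integral_hasStrictDerivAt 0 w).hasDerivAt.const_add _

lemma hasDerivAt_upperTail (hc : 0 < c) (hk : k ≠ 0) (w : ℝ) :
    HasDerivAt (upperTail c k) (-expPow c k w) w := by
  have h : upperTail c k = fun u => (∫ t, expPow c k t) - lowerTail c k u := by
    funext u
    rw [← lowerTail_add_upperTail hc hk u]; ring
  rw [h]
  exact (hasDerivAt_lowerTail hc hk w).const_sub _

lemma hasDerivAt_const_mul_pow (c : ℝ) (k : ℕ) (w : ℝ) :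
    HasDerivAt (fun t : ℝ => c * t ^ (2 * k)) (2 * k * c * w ^ (2 * k - 1)) w := by
  have := (hasDerivAt_pow (2 * k) w).const_mul c
  refine this.congr_deriv ?_
  push_cast; ring

lemma hasDerivAt_expPow (c : ℝ) (k : ℕ) (w : ℝ) :
    HasDerivAt (expPow c k) (-(2 * k * c * w ^ (2 * k - 1)) * expPow c k w) w := by
  have := (hasDerivAt_const_mul_pow (-c) k w).exp
  refine this.congr_deriv ?_
  simp only [expPow]; ring

lemma tendsto_expPow_atTop (hc : 0 < c) (hk : k ≠ 0) :
    Tendsto (expPow c k) atTop (𝓝 0) := by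
  refine Real.tendsto_exp_atBot.comp ?_
  have h : Tendsto (fun t : ℝ => t ^ (2 * k)) atTop atTop := tendsto_pow_atTop (by omega)
  exact h.const_mul_atTop_of_neg (by linarith)

/-- Mills-ratio bound. -/
lemma deriv_mul_upperTail_le (hc : 0 < c) (hk : k ≠ 0) {w : ℝ} (hw : 0 ≤ w) :
    2 * k * c * w ^ (2 * k - 1) * upperTail c k w ≤ expPow c k w := by
  -- The weight `2kc x^(2k-1)` turns the density into an exact derivative and is increasing on `[0,
  -- ∞)`, so it can be pulled inside the tail integral.
  have hd : ∀ x : ℝ, HasDerivAt (fun t => -expPow c k t)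
      (2 * k * c * x ^ (2 * k - 1) * expPow c k x) x := fun x =>
    (hasDerivAt_expPow c k x).neg.congr_deriv (by ring)
  have hlim : Tendsto (fun t => -expPow c k t) atTop (𝓝 0) := by
    simpa using (tendsto_expPow_atTop hc hk).neg
  have hnn : ∀ x ∈ Ioi w, 0 ≤ 2 * k * c * x ^ (2 * k - 1) * expPow c k x := fun x hx => by
    have : 0 ≤ x := hw.trans (le_of_lt hx)
    have := expPow_pos c k x
    positivity
  have hint := integrableOn_Ioi_deriv_of_nonneg (hd w).continuousAt.continuousWithinAt
    (fun x _ => hd x) hnn hlim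
  have heq := integral_Ioi_of_hasDerivAt_of_nonneg (hd w).continuousAt.continuousWithinAt
    (fun x _ => hd x) hnn hlim
  rw [upperTail, ← integral_const_mul]
  calc _ ≤ ∫ x in Ioi w, 2 * k * c * x ^ (2 * k - 1) * expPow c k x := by
        refine setIntegral_mono_on ((integrable_expPow hc hk).integrableOn.const_mul _) hint
          measurableSet_Ioi fun x hx => ?_
        have := expPow_pos c k x
        have hwx : w ≤ x := le_of_lt hx
        gcongr
    _ = expPow c k w := by rw [heq]; ring

lemma hasDerivAt_inv_mul_lowerTail (hc : 0 < c) (hk : k ≠ 0) (w : ℝ) :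
    HasDerivAt (fun t => (expPow c k t)⁻¹ * lowerTail c k t)
      (2 * k * c * w ^ (2 * k - 1) * ((expPow c k w)⁻¹ * lowerTail c k w) + 1) w := by
  have h0 := (expPow_pos c k w).ne'
  refine (((hasDerivAt_expPow c k w).inv h0).mul (hasDerivAt_lowerTail hc hk w)).congr_deriv ?_
  simp only [Pi.inv_apply]
  field_simp

lemma hasDerivAt_inv_mul_upperTail (hc : 0 < c) (hk : k ≠ 0) (w : ℝ) :
    HasDerivAt (fun t => (expPow c k t)⁻¹ * upperTail c k t)
      (2 * k * c * w ^ (2 * k - 1) * ((expPow c k w)⁻¹ * upperTail c k w) - 1) w := by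
  have h0 := (expPow_pos c k w).ne'
  refine (((hasDerivAt_expPow c k w).inv h0).mul (hasDerivAt_upperTail hc hk w)).congr_deriv ?_
  simp only [Pi.inv_apply]
  field_simp
  ring

/-- By the Mills bound the derivative of the ratio is nonpositive on `[0, ∞)`, so the ratio is
largest at `0`, where the density is `1`. -/
lemma inv_mul_upperTail_le (hc : 0 < c) (hk : k ≠ 0) {w : ℝ} (hw : 0 ≤ w) :
    (expPow c k w)⁻¹ * upperTail c k w ≤ upperTail c k 0 := by
  have hd := hasDerivAt_inv_mul_upperTail (c := c) (k := k) hc hk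
  have h : AntitoneOn (fun t => (expPow c k t)⁻¹ * upperTail c k t) (Ici 0) := by
    refine antitoneOn_of_deriv_nonpos (convex_Ici 0)
      (fun x _ => (hd x).continuousAt.continuousWithinAt)
      (fun x _ => (hd x).differentiableAt.differentiableWithinAt) fun x hx => ?_
    rw [(hd x).deriv]
    have hx0 : 0 ≤ x := by simpa using interior_subset hx
    have h1 := deriv_mul_upperTail_le hc hk hx0
    have h2 := expPow_pos c k x
    have : 2 * k * c * x ^ (2 * k - 1) * ((expPow c k x)⁻¹ * upperTail c k x) ≤ 1 := by
      rw [mul_left_comm, inv_mul_le_iff₀ h2, mul_one]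
      exact h1
    linarith
  have := h (mem_Ici.2 le_rfl) (mem_Ici.2 hw) hw
  simpa [expPow, hk] using this

/-- The coefficient `c` will depend on `n` through a moment; this monotonicity makes the Stein
bounds uniform in it. -/
lemma upperTail_anti_coeff {c₀ : ℝ} (hc₀ : 0 < c₀) (hcc : c₀ ≤ c) (hk : k ≠ 0) :
    upperTail c k 0 ≤ upperTail c₀ k 0 := by
  refine setIntegral_mono (integrable_expPow (hc₀.trans_le hcc) hk).integrableOn
    (integrable_expPow hc₀ hk).integrableOn fun t => ?_
  refine Real.exp_le_exp.2 ?_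
  have : 0 ≤ t ^ (2 * k) := (even_two_mul k).pow_nonneg _
  nlinarith

lemma expPowLaw_real_Iic (hc : 0 < c) (hk : k ≠ 0) (z : ℝ) :
    (expPowLaw c (2 * k)).real (Iic z) = lowerTail c k z / (lowerTail c k z + upperTail c k z) := by
  rw [lowerTail_add_upperTail hc hk, measureReal_def, expPowLaw, tilted_apply_eq_ofReal_integral,
    integral_div, ENNReal.toReal_ofReal]
  · rfl
  · exact div_nonneg (lowerTail_pos hc hk z).le (integral_nonneg fun t => (expPow_pos c k t).le)

end Tails


/-! ### The Stein equation for half-line indicators. -/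

/-- The solution of the Stein equation of `expPowLaw c (2k)` for the indicator of `(-∞, z]`. -/
noncomputable def steinSol (c : ℝ) (k : ℕ) (z w : ℝ) : ℝ :=
  if w ≤ z then upperTail c k z / (lowerTail c k z + upperTail c k z) *
    ((expPow c k w)⁻¹ * lowerTail c k w)
  else lowerTail c k z / (lowerTail c k z + upperTail c k z) *
    ((expPow c k w)⁻¹ * upperTail c k w)

/-- The (left) derivative of the Stein solution, as prescribed by the Stein equation. -/
noncomputable def steinDeriv (c : ℝ) (k : ℕ) (z w : ℝ) : ℝ :=
  2 * k * c * w ^ (2 * k - 1) * steinSol c k z w + (if w ≤ z then 1 else 0) -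
    lowerTail c k z / (lowerTail c k z + upperTail c k z)

section Stein

variable {c : ℝ} {k : ℕ}

lemma steinSol_nonneg (hc : 0 < c) (hk : k ≠ 0) (z w : ℝ) : 0 ≤ steinSol c k z w := by
  have h1 := lowerTail_pos hc hk z
  have h2 := upperTail_pos hc hk z
  have h3 := lowerTail_pos hc hk w
  have h4 := upperTail_pos hc hk w
  have h5 := expPow_pos c k w
  unfold steinSol
  split_ifs <;> positivity

/-- Both one-sided ratios dominate the solution, whichever branch `w` is in, because the tails are
monotone. This bound is the useful one for `w ≤ 0`, and `steinSol_le_upper` for `w ≥ 0`. -/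
lemma steinSol_le_lower (hc : 0 < c) (hk : k ≠ 0) (z w : ℝ) :
    steinSol c k z w ≤ (expPow c k w)⁻¹ * lowerTail c k w := by
  have h1 := lowerTail_pos hc hk z
  have h2 := upperTail_pos hc hk z
  have h3 := lowerTail_pos hc hk w
  have h4 := upperTail_pos hc hk w
  have h5 := expPow_pos c k w
  unfold steinSol
  split_ifs with h
  · refine mul_le_of_le_one_left (by positivity) ?_
    rw [div_le_one (by positivity)]; linarith
  · rw [mul_left_comm]
    refine mul_le_mul_of_nonneg_left ?_ (by positivity)
    rw [div_mul_eq_mul_div, div_le_iff₀ (by positivity)]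
    have h6 := lowerTail_mono hc hk (not_le.1 h).le
    have h7 := lowerTail_add_upperTail hc hk w
    have h8 := lowerTail_add_upperTail hc hk z
    have h9 : upperTail c k w ≤ lowerTail c k z + upperTail c k z := by linarith
    exact mul_le_mul h6 h9 h4.le h3.le

lemma steinSol_le_upper (hc : 0 < c) (hk : k ≠ 0) (z w : ℝ) :
    steinSol c k z w ≤ (expPow c k w)⁻¹ * upperTail c k w := by
  have h1 := lowerTail_pos hc hk z
  have h2 := upperTail_pos hc hk z
  have h3 := lowerTail_pos hc hk w
  have h4 := upperTail_pos hc hk w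
  have h5 := expPow_pos c k w
  unfold steinSol
  split_ifs with h
  · rw [mul_left_comm]
    refine mul_le_mul_of_nonneg_left ?_ (by positivity)
    rw [div_mul_eq_mul_div, div_le_iff₀ (by positivity)]
    have h6 := lowerTail_mono hc hk h
    have h7 := lowerTail_add_upperTail hc hk w
    have h8 := lowerTail_add_upperTail hc hk z
    have h9 : upperTail c k z ≤ upperTail c k w := by linarith
    have h10 : lowerTail c k w ≤ lowerTail c k z + upperTail c k z := by linarith
    exact mul_le_mul h9 h10 h3.le h4.le
  · refine mul_le_of_le_one_left (by positivity) ?_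
    rw [div_le_one (by positivity)]; linarith

lemma steinSol_le (hc : 0 < c) (hk : k ≠ 0) (z w : ℝ) :
    steinSol c k z w ≤ upperTail c k 0 := by
  rcases le_total 0 w with hw | hw
  · exact (steinSol_le_upper hc hk z w).trans (inv_mul_upperTail_le hc hk hw)
  · refine (steinSol_le_lower hc hk z w).trans ?_
    have := inv_mul_upperTail_le hc hk (neg_nonneg.2 hw)
    rwa [expPow_neg, upperTail_eq_lowerTail_neg, neg_neg] at this

lemma abs_steinSol_le (hc : 0 < c) (hk : k ≠ 0) (z w : ℝ) :
    |steinSol c k z w| ≤ upperTail c k 0 := by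
  rw [abs_of_nonneg (steinSol_nonneg hc hk z w)]
  exact steinSol_le hc hk z w

/-- By evenness the ratio on the side of `w` is the upper ratio at `|w|`, and the Mills bound
applies there. -/
lemma abs_deriv_mul_steinSol_le (hc : 0 < c) (hk : k ≠ 0) (z w : ℝ) :
    |2 * k * c * w ^ (2 * k - 1) * steinSol c k z w| ≤ 1 := by
  have key : ∀ {x : ℝ}, 0 ≤ x →
      2 * k * c * x ^ (2 * k - 1) * ((expPow c k x)⁻¹ * upperTail c k x) ≤ 1 := fun {x} hx => by
    rw [mul_left_comm, inv_mul_le_iff₀ (expPow_pos c k x), mul_one]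
    exact deriv_mul_upperTail_le hc hk hx
  have hf := steinSol_nonneg hc hk z w
  rw [abs_mul, abs_of_nonneg hf]
  have habs : |2 * k * c * w ^ (2 * k - 1)| = 2 * k * c * |w| ^ (2 * k - 1) := by
    rw [abs_mul, abs_pow, abs_of_nonneg (by positivity : (0 : ℝ) ≤ 2 * k * c)]
  rw [habs]
  refine le_trans ?_ (key (abs_nonneg w))
  refine mul_le_mul_of_nonneg_left ?_ (by positivity)
  rcases le_total 0 w with hw | hw
  · rw [abs_of_nonneg hw]; exact steinSol_le_upper hc hk z w
  · rw [abs_of_nonpos hw, expPow_neg, upperTail_eq_lowerTail_neg, neg_neg]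
    exact steinSol_le_lower hc hk z w

lemma abs_steinDeriv_le (hc : 0 < c) (hk : k ≠ 0) (z w : ℝ) : |steinDeriv c k z w| ≤ 2 := by
  have h1 := lowerTail_pos hc hk z
  have h2 := upperTail_pos hc hk z
  have h3 := abs_le.1 (abs_deriv_mul_steinSol_le hc hk z w)
  have h4 : 0 ≤ lowerTail c k z / (lowerTail c k z + upperTail c k z) := by positivity
  have h5 : lowerTail c k z / (lowerTail c k z + upperTail c k z) ≤ 1 := by
    rw [div_le_one (by positivity)]; linarith
  unfold steinDeriv
  rw [abs_le]
  split_ifs <;> constructor <;> linarith [h3.1, h3.2]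

lemma one_sub_lowerTail_div (hc : 0 < c) (hk : k ≠ 0) (z : ℝ) :
    upperTail c k z / (lowerTail c k z + upperTail c k z) =
      1 - lowerTail c k z / (lowerTail c k z + upperTail c k z) := by
  have h1 := lowerTail_pos hc hk z
  have h2 := upperTail_pos hc hk z
  field_simp
  ring

/-- The two branches agree at `w = z`, so the right-hand formula holds on the closed half-line. -/
lemma steinSol_eq_of_ge {z w : ℝ} (h : z ≤ w) : steinSol c k z w =
    lowerTail c k z / (lowerTail c k z + upperTail c k z) *
      ((expPow c k w)⁻¹ * upperTail c k w) := by
  rcases h.eq_or_lt with rfl | h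
  · simp only [steinSol, le_refl, if_true]; ring
  · simp [steinSol, not_le.2 h]

lemma hasDerivWithinAt_steinSol_Iic (hc : 0 < c) (hk : k ≠ 0) {z w : ℝ} (hw : w ≤ z) :
    HasDerivWithinAt (steinSol c k z) (steinDeriv c k z w) (Iic z) w := by
  have h := ((hasDerivAt_inv_mul_lowerTail hc hk w).const_mul
    (upperTail c k z / (lowerTail c k z + upperTail c k z))).hasDerivWithinAt (s := Iic z)
  refine (h.congr (fun x hx => by simp [steinSol, mem_Iic.1 hx])
    (by simp [steinSol, hw])).congr_deriv ?_
  simp only [steinDeriv, steinSol, hw, if_true]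
  rw [one_sub_lowerTail_div hc hk]
  ring

lemma hasDerivWithinAt_steinSol_Ioi (hc : 0 < c) (hk : k ≠ 0) {z w : ℝ} (hw : z < w) :
    HasDerivWithinAt (steinSol c k z) (steinDeriv c k z w) (Ici z) w := by
  have h := ((hasDerivAt_inv_mul_upperTail hc hk w).const_mul
    (lowerTail c k z / (lowerTail c k z + upperTail c k z))).hasDerivWithinAt (s := Ici z)
  refine (h.congr (fun x hx => steinSol_eq_of_ge hx)
    (steinSol_eq_of_ge hw.le)).congr_deriv ?_
  rw [steinDeriv, steinSol_eq_of_ge hw.le, if_neg (not_le.2 hw)]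
  ring

lemma continuous_steinSol (hc : 0 < c) (hk : k ≠ 0) (z : ℝ) : Continuous (steinSol c k z) := by
  have h1 : Continuous fun w => (expPow c k w)⁻¹ * lowerTail c k w :=
    continuous_iff_continuousAt.2 fun w => (hasDerivAt_inv_mul_lowerTail hc hk w).continuousAt
  have h2 : Continuous fun w => (expPow c k w)⁻¹ * upperTail c k w :=
    continuous_iff_continuousAt.2 fun w => (hasDerivAt_inv_mul_upperTail hc hk w).continuousAt
  refine Continuous.if_le (h1.const_mul _) (h2.const_mul _) continuous_id continuous_const ?_
  intro w hw
  subst hw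
  ring

/-- Mean value inequality on the two sides of `z`. -/
lemma steinSol_sub_sub_le (hc : 0 < c) (hk : k ≠ 0) {z a b D C : ℝ} (hab : a ≤ b)
    (hz : b ≤ z ∨ z ≤ a) (hD : ∀ x ∈ Ioo a b, |steinDeriv c k z x - D| ≤ C) :
    |steinSol c k z b - steinSol c k z a - (b - a) * D| ≤ C * (b - a) := by
  rcases hab.eq_or_lt with rfl | hab'
  · simp
  have hd : ∀ x ∈ Ioo a b, HasDerivAt (steinSol c k z) (steinDeriv c k z x) x := by
    intro x hx
    rcases hz with hz | hz
    · exact (hasDerivWithinAt_steinSol_Iic hc hk (hx.2.le.trans hz)).hasDerivAt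
        (Iic_mem_nhds (hx.2.trans_le hz))
    · exact (hasDerivWithinAt_steinSol_Ioi hc hk (hz.trans_lt hx.1)).hasDerivAt
        (Ici_mem_nhds (hz.trans_lt hx.1))
  obtain ⟨x, hx, hxe⟩ := exists_hasDerivAt_eq_slope _ _ hab'
    (continuous_steinSol hc hk z).continuousOn hd
  have hba : 0 < b - a := sub_pos.2 hab'
  have h1 : steinSol c k z b - steinSol c k z a = (b - a) * steinDeriv c k z x := by
    rw [hxe]; field_simp
  rw [h1, ← mul_sub, abs_mul, abs_of_pos hba, mul_comm]
  exact mul_le_mul_of_nonneg_right (hD x hx) hba.le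

/-- Only the derivative jumps at `z`; the solution is continuous there, so an interval straddling
`z` can be cut at `z` and the two Lipschitz bounds added. -/
lemma abs_steinSol_sub_le (hc : 0 < c) (hk : k ≠ 0) (z x y : ℝ) :
    |steinSol c k z y - steinSol c k z x| ≤ 2 * |y - x| := by
  have key : ∀ {a b : ℝ}, a ≤ b → |steinSol c k z b - steinSol c k z a| ≤ 2 * (b - a) := by
    intro a b hab
    have hside : ∀ {a b : ℝ}, a ≤ b → (b ≤ z ∨ z ≤ a) →
        |steinSol c k z b - steinSol c k z a| ≤ 2 * (b - a) := fun {a b} hab hz => by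
      simpa using steinSol_sub_sub_le hc hk (D := 0) hab hz fun x _ => by
        simpa using abs_steinDeriv_le hc hk z x
    by_cases hz : b ≤ z ∨ z ≤ a
    · exact hside hab hz
    · push Not at hz
      have h1 := hside hz.2.le (Or.inl le_rfl)
      have h2 := hside hz.1.le (Or.inr le_rfl)
      have := abs_sub_le (steinSol c k z b) (steinSol c k z z) (steinSol c k z a)
      linarith
  rcases le_total x y with h | h
  · rw [abs_of_nonneg (sub_nonneg.2 h)]; exact key h
  · rw [abs_sub_comm, abs_sub_comm y x, abs_of_nonneg (sub_nonneg.2 h)]; exact key h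

/-- From `1 + |w| ≤ 2 max(1, |w|)`, whence `4^k = 2^(2k)`. All polynomial growth is absorbed into `1
+ w^(2k)`, whose expectation is bounded uniformly in `n`. -/
lemma one_add_abs_pow_le {k m : ℕ} (hm : m ≤ 2 * k) (w : ℝ) :
    (1 + |w|) ^ m ≤ 4 ^ k * (1 + w ^ (2 * k)) := by
  have h1 : (1 + |w|) ^ m ≤ (1 + |w|) ^ (2 * k) :=
    pow_le_pow_right₀ (by linarith [abs_nonneg w]) hm
  have h2 : (1 + |w|) ^ (2 * k) ≤ (2 * max 1 |w|) ^ (2 * k) := by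
    gcongr
    linarith [le_max_left 1 |w|, le_max_right 1 |w|]
  have h3 : (2 * max 1 |w|) ^ (2 * k) = 4 ^ k * max 1 |w| ^ (2 * k) := by
    rw [mul_pow, pow_mul]; norm_num
  have h4 : max 1 |w| ^ (2 * k) ≤ 1 + w ^ (2 * k) := by
    have h5 : 0 ≤ w ^ (2 * k) := (even_two_mul k).pow_nonneg _
    rcases max_choice 1 |w| with h | h <;> rw [h]
    · rw [one_pow]; linarith
    · rw [(even_two_mul k).pow_abs]; linarith
  calc _ ≤ 4 ^ k * max 1 |w| ^ (2 * k) := by linarith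
    _ ≤ _ := by gcongr

/-- Local Lipschitz bound for the derivative of the Stein solution, away from the jump. -/
lemma abs_steinDeriv_sub_le (hc : 0 < c) (hk : k ≠ 0) {z w x : ℝ} (hx : |x - w| ≤ 1)
    (hz : w ≤ z ↔ x ≤ z) : |steinDeriv c k z x - steinDeriv c k z w| ≤
      4 * k ^ 2 * c * 4 ^ k * (upperTail c k 0 + 1) * |x - w| * (1 + w ^ (2 * k)) := by
  set f := steinSol c k z
  -- Since `x` and `w` lie on the same side of `z`, the indicators in the Stein equation cancel and
  -- only the product term varies.
  have h1 : steinDeriv c k z x - steinDeriv c k z w =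
      2 * k * c * (x ^ (2 * k - 1) - w ^ (2 * k - 1)) * f x +
        2 * k * c * w ^ (2 * k - 1) * (f x - f w) := by
    simp only [steinDeriv, hz, f]; ring
  have hM := upperTail_pos hc hk 0
  have hk1 : (1 : ℝ) ≤ k := by exact_mod_cast Nat.one_le_iff_ne_zero.2 hk
  have hw := abs_nonneg w
  have h2 : |x ^ (2 * k - 1) - w ^ (2 * k - 1)| ≤
      |x - w| * (2 * k) * (4 ^ k * (1 + w ^ (2 * k))) := by
    refine (abs_pow_sub_pow_le _ _ _).trans ?_
    have hmax : max |x| |w| ≤ 1 + |w| := by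
      refine max_le ?_ (by linarith)
      have := abs_sub_abs_le_abs_sub x w
      linarith
    have h3 : max |x| |w| ^ (2 * k - 1 - 1) ≤ 4 ^ k * (1 + w ^ (2 * k)) :=
      (pow_le_pow_left₀ (hw.trans (le_max_right _ _)) hmax _).trans
        (one_add_abs_pow_le (by omega) w)
    have h4 : ((2 * k - 1 : ℕ) : ℝ) ≤ 2 * k := by exact_mod_cast Nat.sub_le _ _
    have h5 : 0 ≤ max |x| |w| := hw.trans (le_max_right _ _)
    gcongr
  have h3 : |w ^ (2 * k - 1)| ≤ 4 ^ k * (1 + w ^ (2 * k)) := by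
    rw [abs_pow]
    exact (pow_le_pow_left₀ hw (by linarith) _).trans (one_add_abs_pow_le (by omega) w)
  have h4 := abs_steinSol_sub_le hc hk z w x
  have h5 := abs_steinSol_le hc hk z x
  have hP : 0 ≤ 4 ^ k * (1 + w ^ (2 * k)) := (abs_nonneg _).trans h3
  rw [h1]
  refine (abs_add_le _ _).trans ?_
  rw [abs_mul _ (f x), abs_mul _ (x ^ _ - _), abs_mul _ (f x - f w), abs_mul _ (w ^ _),
    abs_of_nonneg (by positivity : (0 : ℝ) ≤ 2 * k * c)]
  calc _ ≤ 2 * k * c * (|x - w| * (2 * k) * (4 ^ k * (1 + w ^ (2 * k)))) * upperTail c k 0 +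
        2 * k * c * (4 ^ k * (1 + w ^ (2 * k))) * (2 * |x - w|) := by
        gcongr
    _ = 4 * k * (k * upperTail c k 0 + 1) * c * |x - w| * (4 ^ k * (1 + w ^ (2 * k))) := by ring
    _ ≤ 4 * k * (k * upperTail c k 0 + k) * c * |x - w| * (4 ^ k * (1 + w ^ (2 * k))) := by
        gcongr
    _ = _ := by ring

/-- Uniform bounds for the solution `f` of the Stein equation
`f' - 2kc w^(2k-1) f = 1_{(-∞, z]} - F(z)`, with `c` in a compact subset of `(0, ∞)`. -/
theorem exists_stein_solution (hk : k ≠ 0) {c₀ c₁ : ℝ} (hc₀ : 0 < c₀) :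
    ∃ D : ℝ, 0 ≤ D ∧ ∀ c, c₀ ≤ c → c ≤ c₁ → ∀ z : ℝ, ∃ f f' : ℝ → ℝ,
      (∀ w, |f w| ≤ D) ∧ (∀ w, |f' w| ≤ 2) ∧
      (∀ w, f' w - 2 * k * c * w ^ (2 * k - 1) * f w =
        (if w ≤ z then 1 else 0) - (expPowLaw c (2 * k)).real (Iic z)) ∧
      (∀ w u, |u| ≤ 1 → |f (w + u) - f w - u * f' w| ≤
        |u| * (D * |u| * (1 + w ^ (2 * k)) + if |w - z| ≤ |u| then 4 else 0)) ∧
      (∀ w u, |u| ≤ 1 → |f' (w + u) - f' w| ≤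
        D * |u| * (1 + w ^ (2 * k)) + if |w - z| ≤ |u| then 4 else 0) := by
  -- The first summand is the local Lipschitz constant of the derivative, the second the sup bound
  -- of the solution, both taken at the worst `c` in `[c₀, c₁]`.
  set D := 4 * k ^ 2 * |c₁| * 4 ^ k * (upperTail c₀ k 0 + 1) + upperTail c₀ k 0 with hD
  have hM₀ := upperTail_pos hc₀ hk 0
  have hD0 : 0 ≤ D := by positivity
  refine ⟨D, hD0, fun c h0 h1 z => ?_⟩
  have hc : 0 < c := hc₀.trans_le h0
  have hM := upperTail_pos hc hk 0
  have hMM := upperTail_anti_coeff hc₀ h0 hk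
  have hlip : ∀ w x : ℝ, |x - w| ≤ 1 → (w ≤ z ↔ x ≤ z) →
      |steinDeriv c k z x - steinDeriv c k z w| ≤ D * |x - w| * (1 + w ^ (2 * k)) := by
    intro w x hx hz
    refine (abs_steinDeriv_sub_le hc hk hx hz).trans ?_
    have hw : 0 ≤ w ^ (2 * k) := (even_two_mul k).pow_nonneg _
    have hcc : c ≤ |c₁| := h1.trans (le_abs_self _)
    have : 4 * k ^ 2 * c * 4 ^ k * (upperTail c k 0 + 1) ≤ D := by
      have : 4 * k ^ 2 * c * 4 ^ k * (upperTail c k 0 + 1) ≤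
        4 * k ^ 2 * |c₁| * 4 ^ k * (upperTail c₀ k 0 + 1) := by gcongr
      linarith
    gcongr
  refine ⟨steinSol c k z, steinDeriv c k z, fun w => ?_, abs_steinDeriv_le hc hk z, fun w => ?_,
    fun w u hu => ?_, fun w u hu => ?_⟩
  · refine (abs_steinSol_le hc hk z w).trans (hMM.trans ?_)
    rw [hD]
    have : 0 ≤ 4 * k ^ 2 * |c₁| * 4 ^ k * (upperTail c₀ k 0 + 1) := by positivity
    linarith
  · rw [expPowLaw_real_Iic hc hk, steinDeriv]; ring
  · have hw : 0 ≤ w ^ (2 * k) := (even_two_mul k).pow_nonneg _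
    -- If the jump may lie between `w` and `w + u`, the crude bounds `2|u|` on the increment and on
    -- the linear term add up to `4|u|`. Otherwise the whole segment is on one side of `z`.
    by_cases hwz : |w - z| ≤ |u|
    · rw [if_pos hwz]
      have h2 := abs_steinSol_sub_le hc hk z w (w + u)
      rw [add_sub_cancel_left] at h2
      have h3 := abs_steinDeriv_le hc hk z w
      have h4 : |u * steinDeriv c k z w| ≤ |u| * 2 := by rw [abs_mul]; gcongr
      have h5 := abs_sub (steinSol c k z (w + u) - steinSol c k z w) (u * steinDeriv c k z w)
      have h6 : 0 ≤ |u| * (D * |u| * (1 + w ^ (2 * k))) := by positivity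
      linarith
    · rw [if_neg hwz, add_zero]
      push Not at hwz
      rcases le_total 0 u with h | h
      · rw [abs_of_nonneg h] at hwz hu ⊢
        have hz : w + u ≤ z ∨ z ≤ w := by
          by_contra! h'
          rw [abs_of_neg (by linarith)] at hwz
          linarith
        have := steinSol_sub_sub_le hc hk (a := w) (b := w + u) (D := steinDeriv c k z w)
          (C := D * u * (1 + w ^ (2 * k))) (by linarith) hz fun x hx => by
            have hxw : |x - w| ≤ u := by rw [abs_le]; constructor <;> linarith [hx.1, hx.2]
            refine (hlip w x (hxw.trans hu) ?_).trans (by gcongr)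
            rcases hz with hz | hz
            · exact ⟨fun _ => by linarith [hx.2], fun _ => by linarith⟩
            -- At `w = z` the derivative is the left one, so equality has to be excluded; it would
            -- contradict `u < |w - z|`.
            · have : z < w := by
                rcases hz.eq_or_lt with rfl | h'
                · simp at hwz; linarith
                · exact h'
              exact ⟨fun _ => by linarith, fun _ => by linarith [hx.1]⟩
        rw [add_sub_cancel_left] at this
        linarith
      · rw [abs_of_nonpos h] at hwz hu ⊢
        have hz : w ≤ z ∨ z ≤ w + u := by
          by_contra! h'
          rw [abs_of_pos (by linarith)] at hwz
          linarith
        have := steinSol_sub_sub_le hc hk (a := w + u) (b := w) (D := steinDeriv c k z w)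
          (C := D * (-u) * (1 + w ^ (2 * k))) (by linarith) hz fun x hx => by
            have hxw : |x - w| ≤ -u := by rw [abs_le]; constructor <;> linarith [hx.1, hx.2]
            refine (hlip w x (hxw.trans hu) ?_).trans (by gcongr)
            rcases hz with hz | hz
            · exact ⟨fun _ => by linarith [hx.2], fun _ => by linarith⟩
            · exact ⟨fun _ => by linarith [hx.1, hx.2], fun _ => by linarith [hx.1]⟩
        rw [← abs_neg]
        convert this using 1
        · congr 1; ring
        · ring
  · by_cases hwz : |w - z| ≤ |u|
    · rw [if_pos hwz]
      have hw : 0 ≤ w ^ (2 * k) := (even_two_mul k).pow_nonneg _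
      have h3 := abs_steinDeriv_le hc hk z w
      have h4 := abs_steinDeriv_le hc hk z (w + u)
      have h5 := abs_sub (steinDeriv c k z (w + u)) (steinDeriv c k z w)
      have h6 : 0 ≤ D * |u| * (1 + w ^ (2 * k)) := by positivity
      linarith
    · rw [if_neg hwz, add_zero]
      have := hlip w (w + u) (by simpa using hu) ?_
      · simpa using this
      · push Not at hwz
        constructor
        · intro h'
          rw [abs_sub_comm, abs_of_nonneg (sub_nonneg.2 h')] at hwz
          linarith [le_abs_self u]
        · intro h'
          by_contra! h''
          rw [abs_of_pos (sub_pos.2 h'')] at hwz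
          linarith [neg_abs_le u]

end Stein


/-! ### Single-site conditional distributions of the Gibbs measure. -/

/-- The total spin of all sites other than `j`. -/
noncomputable def otherSpin {n : ℕ} (ω : Config n) (j : Fin n) : ℝ := totalSpin ω - spin ω j

/-- The conditional mean of a spin with weights `1, α e^θ, α e^(-θ)` on `0, 1, -1`. -/
noncomputable def condMean (α θ : ℝ) : ℝ := 2 * α * Real.sinh θ / (1 + 2 * α * Real.cosh θ)

/-- The conditional second moment of a spin with weights `1, α e^θ, α e^(-θ)` on `0, 1, -1`. -/
noncomputable def condSq (α θ : ℝ) : ℝ := 2 * α * Real.cosh θ / (1 + 2 * α * Real.cosh θ)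

/-- The weight of a nonzero spin in the single-site conditional distributions. -/
noncomputable def siteWeight (β K : ℝ) (n : ℕ) : ℝ := Real.exp (-β + β * K / n)

section Gibbs

variable {n : ℕ}

lemma spin_sq_le_one (ω : Config n) (j : Fin n) : spin ω j ^ 2 ≤ 1 := by
  have h := (ω j).2
  simp only [Finset.mem_insert, Finset.mem_singleton] at h
  rcases h with h | h | h <;> simp [spin, h]

lemma abs_spin_le_one (ω : Config n) (j : Fin n) : |spin ω j| ≤ 1 :=
  (sq_le_one_iff_abs_le_one _).1 (spin_sq_le_one ω j)

lemma abs_totalSpin_le (ω : Config n) : |totalSpin ω| ≤ n := by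
  refine (Finset.abs_sum_le_sum_abs _ _).trans ?_
  refine (Finset.sum_le_sum fun j _ => abs_spin_le_one ω j).trans ?_
  simp

lemma otherSpin_eq_sum (ω : Config n) (j : Fin n) :
    otherSpin ω j = ∑ i ∈ Finset.univ.erase j, spin ω i := by
  rw [otherSpin, totalSpin, ← Finset.add_sum_erase _ _ (Finset.mem_univ j)]; ring

lemma otherSpin_update (ω : Config n) (j : Fin n) (a : Spin) :
    otherSpin (Function.update ω j a) j = otherSpin ω j := by
  rw [otherSpin_eq_sum, otherSpin_eq_sum]
  refine Finset.sum_congr rfl fun i hi => ?_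
  simp [spin, Function.update_of_ne (Finset.ne_of_mem_erase hi)]

lemma spin_update (ω : Config n) (j : Fin n) (a : Spin) :
    spin (Function.update ω j a) j = ((a : ℤ) : ℝ) := by
  simp [spin]

lemma productMeasure_real_singleton (ω : Config n) :
    (productMeasure n).real {ω} = (3⁻¹ : ℝ) ^ n := by
  have hρ : ∀ a : Spin, rho {a} = (3 : ENNReal)⁻¹ := by
    rintro ⟨a, ha⟩
    have ha' := ha
    simp only [Finset.mem_insert, Finset.mem_singleton] at ha'
    rcases ha' with rfl | rfl | rfl <;> simp [rho]
  rw [measureReal_def, productMeasure, Measure.pi_singleton]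
  simp [hρ]

/-- The reference measure is uniform, so its weight cancels against the partition function. -/
lemma integral_gibbs (β K : ℝ) (φ : Config n → ℝ) :
    ∫ ω, φ ω ∂(gibbs β K n) = (∑ ω : Config n, Real.exp (-β * hamiltonian n K ω) * φ ω) /
      ∑ ω : Config n, Real.exp (-β * hamiltonian n K ω) := by
  rw [gibbs, integral_tilted, integral_fintype Integrable.of_finite,
    integral_fintype Integrable.of_finite, Finset.sum_div]
  simp only [productMeasure_real_singleton, smul_eq_mul, ← Finset.mul_sum]
  rw [Finset.mul_sum]
  refine Finset.sum_congr rfl fun ω _ => ?_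
  have h : (0 : ℝ) < ∑ ω : Config n, Real.exp (-β * hamiltonian n K ω) := by
    have : Nonempty (Config n) := ⟨fun _ => ⟨0, by decide⟩⟩
    exact Finset.sum_pos (fun _ _ => Real.exp_pos _) Finset.univ_nonempty
  field_simp

/-- Fubini for one coordinate: configurations are grouped by their values off `j`, so a conditional
identity only has to be checked on three-term sums. -/
lemma sum_config_eq_of_update (j : Fin n) {φ ψ : Config n → ℝ}
    (h : ∀ ω, ∑ a, φ (Function.update ω j a) = ∑ a, ψ (Function.update ω j a)) :
    ∑ ω, φ ω = ∑ ω, ψ ω := by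
  -- The spin `0` placed at `j` is a dummy value, overwritten by the update.
  have key : ∀ χ : Config n → ℝ, ∑ ω, χ ω = ∑ η : {i // i ≠ j} → Spin, ∑ a,
      χ (Function.update ((Equiv.funSplitAt j Spin).symm (⟨0, by decide⟩, η)) j a) := by
    intro χ
    rw [← (Equiv.funSplitAt j Spin).symm.sum_comp, Fintype.sum_prod_type_right]
    refine Finset.sum_congr rfl fun η _ => Finset.sum_congr rfl fun a _ => congrArg χ ?_
    funext i
    by_cases hi : i = j
    · subst hi; simp [Equiv.funSplitAt, Equiv.piSplitAt]
    · simp [Equiv.funSplitAt, Equiv.piSplitAt, hi]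
  rw [key φ, key ψ]
  exact Finset.sum_congr rfl fun η _ => h _

lemma sum_spin (φ : ℤ → ℝ) : ∑ a : Spin, φ a = φ (-1) + (φ 0 + φ 1) := by
  rw [Finset.sum_coe_sort ({-1, 0, 1} : Finset ℤ) φ, Finset.sum_insert (by decide),
    Finset.sum_insert (by decide), Finset.sum_singleton]

/-- The diagonal part `(K/n) ω_j²` of the squared sum is the source of the correction `βK/n` in
`siteWeight`. -/
lemma hamiltonian_eq_add (K : ℝ) (ω : Config n) (j : Fin n) :
    hamiltonian n K ω = (∑ i ∈ Finset.univ.erase j, spin ω i ^ 2 - K / n * otherSpin ω j ^ 2) +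
      (spin ω j ^ 2 - K / n * (2 * spin ω j * otherSpin ω j + spin ω j ^ 2)) := by
  rw [hamiltonian, ← Finset.add_sum_erase _ _ (Finset.mem_univ j)]
  have : totalSpin ω = otherSpin ω j + spin ω j := by rw [otherSpin]; ring
  rw [this]; ring

/-- Conditioning on all spins but one: the single-site conditional distribution of the Gibbs
measure has weights `1`, `α e^θ`, `α e^(-θ)` with `α = siteWeight β K n` and
`θ = 2 β K S_j / n`. -/
lemma integral_gibbs_eq_of_site (β K : ℝ) (j : Fin n) {F G : ℝ → ℝ} (q : ℝ → ℝ)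
    (h : ∀ s : ℝ, F 0 + siteWeight β K n * (Real.exp (2 * β * K * (s / n)) * F 1 +
      Real.exp (-(2 * β * K * (s / n))) * F (-1)) =
      (1 + 2 * siteWeight β K n * Real.cosh (2 * β * K * (s / n))) * G s) :
    ∫ ω, F (spin ω j) * q (otherSpin ω j) ∂(gibbs β K n) =
      ∫ ω, G (otherSpin ω j) * q (otherSpin ω j) ∂(gibbs β K n) := by
  rw [integral_gibbs, integral_gibbs]
  congr 1
  refine sum_config_eq_of_update j fun ω => ?_
  set R := ∑ i ∈ Finset.univ.erase j, spin ω i ^ 2 - K / n * otherSpin ω j ^ 2 with hR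
  set s := otherSpin ω j with hs
  have hH : ∀ a : Spin, hamiltonian n K (Function.update ω j a) =
      R + (((a : ℤ) : ℝ) ^ 2 - K / n * (2 * ((a : ℤ) : ℝ) * s + ((a : ℤ) : ℝ) ^ 2)) := by
    intro a
    rw [hamiltonian_eq_add K _ j, otherSpin_update, spin_update, hR]
    congr 2
    refine Finset.sum_congr rfl fun i hi => ?_
    simp [spin, Function.update_of_ne (Finset.ne_of_mem_erase hi)]
  simp only [otherSpin_update, spin_update, hH, ← hs]
  rw [sum_spin fun a => Real.exp (-β * (R + ((a : ℝ) ^ 2 - K / n * (2 * (a : ℝ) * s +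
      (a : ℝ) ^ 2)))) * (F a * q s),
    sum_spin fun a => Real.exp (-β * (R + ((a : ℝ) ^ 2 - K / n * (2 * (a : ℝ) * s +
      (a : ℝ) ^ 2)))) * (G s * q s)]
  -- The three Boltzmann weights share the factor `exp(-β R)`, which carries all dependence on the
  -- other spins except through the field `s`.
  have e0 : Real.exp (-β * (R + (((0 : ℤ) : ℝ) ^ 2 - K / n * (2 * ((0 : ℤ) : ℝ) * s +
      ((0 : ℤ) : ℝ) ^ 2)))) = Real.exp (-β * R) := by
    congr 1; push_cast; ring
  have e1 : Real.exp (-β * (R + (((1 : ℤ) : ℝ) ^ 2 - K / n * (2 * ((1 : ℤ) : ℝ) * s +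
      ((1 : ℤ) : ℝ) ^ 2)))) =
      Real.exp (-β * R) * (siteWeight β K n * Real.exp (2 * β * K * (s / n))) := by
    rw [siteWeight, ← Real.exp_add, ← Real.exp_add]; congr 1; push_cast; ring
  have e2 : Real.exp (-β * (R + (((-1 : ℤ) : ℝ) ^ 2 - K / n * (2 * ((-1 : ℤ) : ℝ) * s +
      ((-1 : ℤ) : ℝ) ^ 2)))) =
      Real.exp (-β * R) * (siteWeight β K n * Real.exp (-(2 * β * K * (s / n)))) := by
    rw [siteWeight, ← Real.exp_add, ← Real.exp_add]; congr 1; push_cast; ring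
  rw [e0, e1, e2]
  have := h s
  rw [Real.cosh_eq] at this
  push_cast
  linear_combination Real.exp (-β * R) * q s * this

lemma siteWeight_pos (β K : ℝ) (n : ℕ) : 0 < siteWeight β K n := Real.exp_pos _

lemma one_add_cosh_pos {α : ℝ} (hα : 0 < α) (θ : ℝ) : 0 < 1 + 2 * α * Real.cosh θ := by
  have := Real.cosh_pos θ; positivity

lemma integral_spin_mul (β K : ℝ) (j : Fin n) (q : ℝ → ℝ) :
    ∫ ω, spin ω j * q (otherSpin ω j) ∂(gibbs β K n) =
      ∫ ω, condMean (siteWeight β K n) (2 * β * K * (otherSpin ω j / n)) * q (otherSpin ω j)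
        ∂(gibbs β K n) := by
  refine integral_gibbs_eq_of_site β K j (F := id)
    (G := fun s => condMean (siteWeight β K n) (2 * β * K * (s / n))) q fun s => ?_
  have := (one_add_cosh_pos (siteWeight_pos β K n) (2 * β * K * (s / n))).ne'
  rw [condMean, mul_div_cancel₀ _ this, Real.sinh_eq]
  simp only [id]; ring

lemma integral_spin_sq_mul (β K : ℝ) (j : Fin n) (q : ℝ → ℝ) :
    ∫ ω, spin ω j ^ 2 * q (otherSpin ω j) ∂(gibbs β K n) =
      ∫ ω, condSq (siteWeight β K n) (2 * β * K * (otherSpin ω j / n)) * q (otherSpin ω j)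
        ∂(gibbs β K n) := by
  refine integral_gibbs_eq_of_site β K j (F := fun a => a ^ 2)
    (G := fun s => condSq (siteWeight β K n) (2 * β * K * (s / n))) q fun s => ?_
  have := (one_add_cosh_pos (siteWeight_pos β K n) (2 * β * K * (s / n))).ne'
  rw [condSq, mul_div_cancel₀ _ this, Real.cosh_eq]
  ring

/-- The conditional mean of the spin at `j` given the other spins. -/
noncomputable def siteMean (β K : ℝ) (ω : Config n) (j : Fin n) : ℝ :=
  condMean (siteWeight β K n) (2 * β * K * (otherSpin ω j / n))

/-- The conditional second moment of the spin at `j` given the other spins. -/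
noncomputable def siteSq (β K : ℝ) (ω : Config n) (j : Fin n) : ℝ :=
  condSq (siteWeight β K n) (2 * β * K * (otherSpin ω j / n))

lemma gibbs_integrable (β K : ℝ) (φ : Config n → ℝ) : Integrable φ (gibbs β K n) :=
  Integrable.of_finite

/-- The leave-one-out identity. -/
lemma integral_mul_totalSpin_sub (β K : ℝ) (g : ℝ → ℝ) :
    ∫ ω, g (totalSpin ω) * (totalSpin ω - ∑ j, siteMean β K ω j) ∂(gibbs β K n) =
      ∑ j, ∫ ω, (g (totalSpin ω) - g (otherSpin ω j)) * (spin ω j - siteMean β K ω j)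
        ∂(gibbs β K n) := by
  -- The conditional mean of `ω_j - m_j` is zero and `g(S_j)` does not involve spin `j`, so
  -- subtracting `g(S_j)` changes nothing.
  have h0 : ∀ j : Fin n,
      ∫ ω, (spin ω j - siteMean β K ω j) * g (otherSpin ω j) ∂(gibbs β K n) = 0 := by
    intro j
    simp only [sub_mul]
    rw [integral_sub (gibbs_integrable _ _ _) (gibbs_integrable _ _ _), sub_eq_zero]
    exact integral_spin_mul β K j g
  have h1 : ∀ j : Fin n,
      ∫ ω, (g (totalSpin ω) - g (otherSpin ω j)) * (spin ω j - siteMean β K ω j)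
        ∂(gibbs β K n) =
      ∫ ω, g (totalSpin ω) * (spin ω j - siteMean β K ω j) ∂(gibbs β K n) := by
    intro j
    rw [← sub_zero (∫ ω, g (totalSpin ω) * (spin ω j - siteMean β K ω j) ∂(gibbs β K n)),
      ← h0 j, ← integral_sub (gibbs_integrable _ _ _) (gibbs_integrable _ _ _)]
    congr 1; funext ω; ring
  simp only [h1]
  rw [← integral_finsetSum _ fun j _ => gibbs_integrable _ _ _]
  congr 1; funext ω
  rw [← Finset.mul_sum, Finset.sum_sub_distrib, totalSpin]

end Gibbs


/-! ### The mean-field force near zero magnetisation. -/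

/-- The Taylor coefficients of `x (1 + 2 A cosh (b x)) - 2 A sinh (b x)`. -/
noncomputable def responseCoeff (A b : ℝ) (j : ℕ) : ℝ :=
  (if j = 0 then 1 else 0) + 2 * A * b ^ (2 * j) * (2 * j + 1 - b) / (2 * j + 1).factorial

/-- The mean-field equation `x = condMean A (b x)` degenerates exactly to order `2k - 1` at `0`,
with all Taylor coefficients nonnegative. -/
structure IsCriticalOrder (A b : ℝ) (k : ℕ) : Prop where
  one_le : 1 ≤ k
  eq_zero : ∀ j < k - 1, responseCoeff A b j = 0
  pos : 0 < responseCoeff A b (k - 1)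
  nonneg : ∀ j ≥ k, 0 ≤ responseCoeff A b j

section Response

variable {A b α θ x : ℝ} {k : ℕ}

lemma hasSum_responseCoeff (A b x : ℝ) : HasSum (fun j => responseCoeff A b j * x ^ (2 * j + 1))
    (x * (1 + 2 * A * Real.cosh (b * x)) - 2 * A * Real.sinh (b * x)) := by
  have h1 := (Real.hasSum_cosh (b * x)).mul_left (2 * A * x)
  have h2 := (Real.hasSum_sinh (b * x)).mul_left (2 * A)
  have h3 := hasSum_ite_eq (0 : ℕ) x
  convert h3.add (h1.sub h2) using 1
  · funext j
    have hf : ((2 * j + 1).factorial : ℝ) = (2 * j + 1) * (2 * j).factorial := by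
      rw [Nat.factorial_succ]; push_cast; ring
    have h0 : ((2 * j).factorial : ℝ) ≠ 0 := by positivity
    have h1 : (2 * j + 1 : ℝ) ≠ 0 := by positivity
    rw [responseCoeff, hf]
    by_cases hj : j = 0
    · subst hj; simp; ring
    · simp only [hj, if_false]; field_simp; ring
  · ring

/-- The numerator of `x - condMean A (b x)`. -/
noncomputable def responseNum (A b x : ℝ) : ℝ :=
  x * (1 + 2 * A * Real.cosh (b * x)) - 2 * A * Real.sinh (b * x)

lemma responseNum_neg (A b x : ℝ) : responseNum A b (-x) = -responseNum A b x := by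
  simp only [responseNum, mul_neg, Real.cosh_neg, Real.sinh_neg]; ring

/-- For `x ≥ 0` every term of the power series is nonnegative, so the sum dominates its leading term
with no remainder and no smallness condition. -/
lemma IsCriticalOrder.le_responseNum (h : IsCriticalOrder A b k) (hx : 0 ≤ x) :
    responseCoeff A b (k - 1) * x ^ (2 * k - 1) ≤ responseNum A b x := by
  have hk := h.one_le
  have e : 2 * k - 1 = 2 * (k - 1) + 1 := by omega
  rw [e]
  refine le_hasSum (hasSum_responseCoeff A b x) (k - 1) fun j hj => ?_
  rcases lt_or_ge j (k - 1) with h1 | h1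
  · simp [h.eq_zero j h1]
  · have := h.nonneg j (by omega)
    positivity

/-- The terms after the leading one have degree above `2k`, so on `[0, 1]` each is at most its
coefficient times `x^(2k)`; the series at `1` bounds the sum of these coefficients. -/
lemma IsCriticalOrder.responseNum_le (h : IsCriticalOrder A b k) (hx : 0 ≤ x) (hx1 : x ≤ 1) :
    responseNum A b x ≤
      responseCoeff A b (k - 1) * x ^ (2 * k - 1) + responseNum A b 1 * x ^ (2 * k) := by
  have hk := h.one_le
  have e : 2 * k - 1 = 2 * (k - 1) + 1 := by omega
  rw [e]
  have h1 := (hasSum_responseCoeff A b 1).mul_right (x ^ (2 * k))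
  simp only [one_pow, mul_one] at h1
  have h2 := hasSum_ite_eq (k - 1) (responseCoeff A b (k - 1) * x ^ (2 * (k - 1) + 1))
  have h3 := h2.add h1
  simp only [responseNum, mul_one]
  refine hasSum_le (fun j => ?_) (hasSum_responseCoeff A b x) (by simpa using h3)
  rcases lt_trichotomy j (k - 1) with hj | rfl | hj
  · simp [h.eq_zero j hj, hj.ne]
  · have := h.pos.le
    simp only [if_true]
    have : 0 ≤ responseCoeff A b (k - 1) * x ^ (2 * k) := by positivity
    linarith
  · have h4 := h.nonneg j (by omega)
    rw [if_neg hj.ne', zero_add]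
    exact mul_le_mul_of_nonneg_left (pow_le_pow_of_le_one hx hx1 (by omega)) h4

lemma IsCriticalOrder.responseNum_one_nonneg (h : IsCriticalOrder A b k) :
    0 ≤ responseNum A b 1 := by
  have := h.le_responseNum zero_le_one
  rw [one_pow, mul_one] at this
  exact h.pos.le.trans this

lemma IsCriticalOrder.abs_responseNum_sub_le (h : IsCriticalOrder A b k) (hx : |x| ≤ 1) :
    |responseNum A b x - responseCoeff A b (k - 1) * x ^ (2 * k - 1)| ≤
      responseNum A b 1 * x ^ (2 * k) := by
  have hk := h.one_le
  have hN := h.responseNum_one_nonneg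
  have key : ∀ {y : ℝ}, 0 ≤ y → y ≤ 1 →
      |responseNum A b y - responseCoeff A b (k - 1) * y ^ (2 * k - 1)| ≤
        responseNum A b 1 * y ^ (2 * k) := by
    intro y h0 h1
    rw [abs_of_nonneg (sub_nonneg.2 (h.le_responseNum h0))]
    linarith [h.responseNum_le h0 h1]
  rcases le_total 0 x with h0 | h0
  · exact key h0 ((le_abs_self x).trans hx)
  · have := key (neg_nonneg.2 h0) ((neg_le_abs x).trans hx)
    have hodd : Odd (2 * k - 1) := ⟨k - 1, by omega⟩
    rw [responseNum_neg, hodd.neg_pow, (even_two_mul k).neg_pow] at this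
    rw [← abs_neg]
    convert this using 2
    ring

lemma sub_condMean (hA : 0 < A) (b x : ℝ) : x - condMean A (b * x) =
    responseNum A b x / (1 + 2 * A * Real.cosh (b * x)) := by
  have := (one_add_cosh_pos hA (b * x)).ne'
  rw [condMean, responseNum]; field_simp

lemma cosh_le_cosh_of_abs_le_one (hx : |x| ≤ 1) :
    Real.cosh (b * x) ≤ Real.cosh b := by
  rw [Real.cosh_le_cosh, abs_mul]
  exact mul_le_of_le_one_right (abs_nonneg _) hx

/-- Coercivity of the force: the product of `x` with the odd numerator is even, so `x ≥ 0` suffices,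
and on `[-1, 1]` the denominator is at most its value at `1`. -/
lemma IsCriticalOrder.le_mul_sub_condMean (h : IsCriticalOrder A b k) (hA : 0 < A)
    (hx : |x| ≤ 1) : responseCoeff A b (k - 1) / (1 + 2 * A * Real.cosh b) * x ^ (2 * k) ≤
      x * (x - condMean A (b * x)) := by
  have hk := h.one_le
  have hD := one_add_cosh_pos hA (b * x)
  have h1 : responseCoeff A b (k - 1) * x ^ (2 * k) ≤ x * responseNum A b x := by
    have key : ∀ {y : ℝ}, 0 ≤ y →
        responseCoeff A b (k - 1) * y ^ (2 * k) ≤ y * responseNum A b y := by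
      intro y hy
      have := mul_le_mul_of_nonneg_left (h.le_responseNum hy) hy
      have e : y ^ (2 * k) = y * y ^ (2 * k - 1) := by
        rw [← pow_succ']; congr 1; omega
      rw [e]; linarith
    rcases le_total 0 x with h0 | h0
    · exact key h0
    · have := key (neg_nonneg.2 h0)
      rwa [responseNum_neg, neg_mul_neg, (even_two_mul k).neg_pow] at this
  rw [sub_condMean hA, ← mul_div_assoc, div_mul_eq_mul_div]
  have h2 := cosh_le_cosh_of_abs_le_one (b := b) hx
  have h3 : 0 ≤ x ^ (2 * k) := (even_two_mul k).pow_nonneg _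
  have h4 := h.pos
  have h5 : 0 ≤ responseCoeff A b (k - 1) * x ^ (2 * k) := by positivity
  gcongr
  exact h5.trans h1

/-- Linear order is enough here: one extra factor `|x|` raises `|x|^(2k-1)` to `x^(2k)`. -/
lemma cosh_sub_one_le (hb : 0 < b) (hx : |x| ≤ 1) :
    Real.cosh (b * x) - 1 ≤ b ^ 2 * Real.exp (b ^ 2) * |x| := by
  have hx2 : x ^ 2 ≤ |x| := by
    rw [← sq_abs]
    nlinarith [abs_nonneg x]
  have h1 := Real.cosh_le_exp_half_sq (b * x)
  set u := (b * x) ^ 2 / 2 with hu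
  have hu0 : 0 ≤ u := by positivity
  have hu1 : u ≤ b ^ 2 * |x| := by
    rw [hu, mul_pow]
    have : b ^ 2 * x ^ 2 ≤ b ^ 2 * |x| := by gcongr
    have : 0 ≤ b ^ 2 * x ^ 2 := by positivity
    linarith
  have hu2 : u ≤ b ^ 2 := hu1.trans (mul_le_of_le_one_right (by positivity) hx)
  have h2 : Real.exp u - 1 ≤ u * Real.exp u := by
    have h3 := Real.add_one_le_exp (-u)
    have h4 := mul_le_mul_of_nonneg_right h3 (Real.exp_pos u).le
    rw [← Real.exp_add, neg_add_cancel, Real.exp_zero] at h4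
    linarith
  calc _ ≤ u * Real.exp u := by linarith
    _ ≤ (b ^ 2 * |x|) * Real.exp (b ^ 2) := by gcongr
    _ = _ := by ring

/-- Two errors add up: the Taylor remainder of the numerator, and the replacement of the denominator
by its value `1 + 2A` at `0`. -/
lemma IsCriticalOrder.abs_sub_condMean_sub_le (h : IsCriticalOrder A b k) (hA : 0 < A)
    (hb : 0 < b) (hx : |x| ≤ 1) :
    |x - condMean A (b * x) - responseCoeff A b (k - 1) / (1 + 2 * A) * x ^ (2 * k - 1)| ≤
      (responseNum A b 1 + responseCoeff A b (k - 1) * (2 * A) * (b ^ 2 * Real.exp (b ^ 2))) *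
        x ^ (2 * k) := by
  have hk := h.one_le
  set e := responseCoeff A b (k - 1)
  set N := responseNum A b x
  set D := 1 + 2 * A * Real.cosh (b * x) with hD
  have he : 0 < e := h.pos
  have hch := Real.one_le_cosh (b * x)
  have hD1 : 1 ≤ D := by
    have : 0 ≤ 2 * A * Real.cosh (b * x) := by positivity
    linarith
  have hD0 : D ≠ 0 := by positivity
  have hE0 : 1 + 2 * A ≠ 0 := by positivity
  have h1 := h.abs_responseNum_sub_le hx
  have h2 := cosh_sub_one_le hb hx
  have e1 : x - condMean A (b * x) - e / (1 + 2 * A) * x ^ (2 * k - 1) =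
      (N - e * x ^ (2 * k - 1)) / D -
        e * (2 * A) * x ^ (2 * k - 1) * (Real.cosh (b * x) - 1) / (D * (1 + 2 * A)) := by
    rw [sub_condMean hA]
    have : Real.cosh (b * x) = (D - 1) / (2 * A) := by rw [hD]; field_simp; ring
    change N / D - _ = _
    rw [this]
    field_simp
    ring
  have h3 : |(N - e * x ^ (2 * k - 1)) / D| ≤ responseNum A b 1 * x ^ (2 * k) := by
    rw [abs_div, abs_of_pos (by linarith : 0 < D)]
    exact (div_le_self (abs_nonneg _) hD1).trans h1
  have h4 : |e * (2 * A) * x ^ (2 * k - 1) * (Real.cosh (b * x) - 1) / (D * (1 + 2 * A))| ≤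
      e * (2 * A) * (b ^ 2 * Real.exp (b ^ 2)) * x ^ (2 * k) := by
    have hDE : 1 ≤ D * (1 + 2 * A) := by nlinarith
    rw [abs_div, abs_of_pos (by linarith : 0 < D * (1 + 2 * A))]
    refine (div_le_self (abs_nonneg _) hDE).trans ?_
    rw [abs_mul, abs_mul, abs_of_pos (by positivity : 0 < e * (2 * A)),
      abs_of_nonneg (by linarith : 0 ≤ Real.cosh (b * x) - 1), abs_pow]
    have e2 : x ^ (2 * k) = |x| ^ (2 * k - 1) * |x| := by
      rw [← (even_two_mul k).pow_abs, ← pow_succ]; congr 1; omega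
    rw [e2]
    calc _ ≤ e * (2 * A) * |x| ^ (2 * k - 1) * (b ^ 2 * Real.exp (b ^ 2) * |x|) := by gcongr
      _ = _ := by ring
  rw [e1]
  refine (abs_sub _ _).trans ?_
  linarith

lemma hasDerivAt_condMean (hα : 0 < α) (θ : ℝ) : HasDerivAt (condMean α)
    ((2 * α * Real.cosh θ + 4 * α ^ 2) / (1 + 2 * α * Real.cosh θ) ^ 2) θ := by
  have h := ((Real.hasDerivAt_sinh θ).const_mul (2 * α)).div
    (((Real.hasDerivAt_cosh θ).const_mul (2 * α)).const_add 1) (one_add_cosh_pos hα θ).ne'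
  refine h.congr_deriv ?_
  congr 1
  linear_combination 4 * α ^ 2 * Real.cosh_sq_sub_sinh_sq θ

lemma hasDerivAt_condSq (hα : 0 < α) (θ : ℝ) : HasDerivAt (condSq α)
    (2 * α * Real.sinh θ / (1 + 2 * α * Real.cosh θ) ^ 2) θ := by
  have h := ((Real.hasDerivAt_cosh θ).const_mul (2 * α)).div
    (((Real.hasDerivAt_cosh θ).const_mul (2 * α)).const_add 1) (one_add_cosh_pos hα θ).ne'
  refine h.congr_deriv ?_
  congr 1
  ring

lemma abs_sinh_le_cosh (θ : ℝ) : |Real.sinh θ| ≤ Real.cosh θ := by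
  rw [abs_le, Real.sinh_eq, Real.cosh_eq]
  constructor <;> linarith [Real.exp_pos θ, Real.exp_pos (-θ)]

/-- The derivative of the mean in the field is the variance of a spin with values in `[-1, 1]`,
hence at most `1`. -/
lemma abs_condMean_sub_le (hα : 0 < α) (θ θ' : ℝ) :
    |condMean α θ - condMean α θ'| ≤ |θ - θ'| := by
  have := (convex_univ (𝕜 := ℝ) (E := ℝ)).norm_image_sub_le_of_norm_hasDerivWithin_le (C := 1)
    (fun x _ => (hasDerivAt_condMean hα x).hasDerivWithinAt) (fun x _ => ?_)
    (mem_univ θ') (mem_univ θ)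
  · simpa using this
  · have h1 := Real.one_le_cosh x
    have h2 := one_add_cosh_pos hα x
    rw [Real.norm_eq_abs, abs_of_nonneg (by positivity), div_le_one (by positivity)]
    have h3 : 4 * α ^ 2 * 1 ≤ 4 * α ^ 2 * Real.cosh x ^ 2 := by
      gcongr
      exact one_le_pow₀ h1
    have h4 : 0 ≤ 2 * α * Real.cosh x := by positivity
    nlinarith

lemma abs_condSq_sub_le (hα : 0 < α) (θ θ' : ℝ) :
    |condSq α θ - condSq α θ'| ≤ |θ - θ'| := by
  have := (convex_univ (𝕜 := ℝ) (E := ℝ)).norm_image_sub_le_of_norm_hasDerivWithin_le (C := 1)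
    (fun x _ => (hasDerivAt_condSq hα x).hasDerivWithinAt) (fun x _ => ?_)
    (mem_univ θ') (mem_univ θ)
  · simpa using this
  · have h1 := Real.one_le_cosh x
    have h2 := one_add_cosh_pos hα x
    have h3 := abs_sinh_le_cosh x
    rw [Real.norm_eq_abs, abs_div, abs_of_pos (by positivity : 0 < (1 + 2 * α * Real.cosh x) ^ 2),
      div_le_one (by positivity), abs_mul, abs_of_pos (by positivity : 0 < 2 * α)]
    have : 2 * α * |Real.sinh x| ≤ 2 * α * Real.cosh x := by gcongr
    nlinarith [mul_pos hα hα]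

lemma abs_condMean_le (hα : 0 < α) (θ : ℝ) : |condMean α θ| ≤ |θ| := by
  simpa [condMean] using abs_condMean_sub_le hα θ 0

lemma abs_condMean_le_one (hα : 0 < α) (θ : ℝ) : |condMean α θ| ≤ 1 := by
  have h2 := one_add_cosh_pos hα θ
  rw [condMean, abs_div, abs_of_pos h2, div_le_one h2, abs_mul,
    abs_of_pos (by positivity : 0 < 2 * α)]
  have := abs_sinh_le_cosh θ
  have : 2 * α * |Real.sinh θ| ≤ 2 * α * Real.cosh θ := by gcongr
  linarith

/-- Used to replace the `n`-dependent site weight by its limit `e^(-β)`, at a cost of order `1/n`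
per site. -/
lemma abs_condMean_weight_sub_le (hA : 0 < A) (hα : A ≤ α) (θ : ℝ) :
    |condMean α θ - condMean A θ| ≤ (α - A) / A := by
  have hα0 : 0 < α := hA.trans_le hα
  have h1 := one_add_cosh_pos hA θ
  have h2 := one_add_cosh_pos hα0 θ
  have hc := Real.one_le_cosh θ
  have h3 := abs_sinh_le_cosh θ
  have e : condMean α θ - condMean A θ = 2 * Real.sinh θ * (α - A) /
      ((1 + 2 * α * Real.cosh θ) * (1 + 2 * A * Real.cosh θ)) := by
    rw [condMean, condMean]; field_simp; ring
  rw [e, abs_div, abs_of_pos (mul_pos h2 h1), div_le_div_iff₀ (mul_pos h2 h1) hA, abs_mul, abs_mul,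
    abs_of_nonneg (sub_nonneg.2 hα), abs_two]
  have h4 : 2 * |Real.sinh θ| * A ≤ (1 + 2 * α * Real.cosh θ) * (1 + 2 * A * Real.cosh θ) := by
    have : 2 * |Real.sinh θ| * A ≤ 2 * Real.cosh θ * A := by gcongr
    have : 0 ≤ 2 * α * Real.cosh θ := by positivity
    nlinarith
  nlinarith [sub_nonneg.2 hα]

lemma condSq_mono_weight (hA : 0 < A) (hα : A ≤ α) (θ : ℝ) : condSq A θ ≤ condSq α θ := by
  have hα0 : 0 < α := hA.trans_le hα
  have hc := Real.one_le_cosh θ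
  rw [condSq, condSq, div_le_div_iff₀ (one_add_cosh_pos hA θ) (one_add_cosh_pos hα0 θ)]
  nlinarith

lemma condSq_weight_sub_le (hA : 0 < A) (hα : A ≤ α) (θ : ℝ) :
    condSq α θ - condSq A θ ≤ (α - A) / A := by
  have hα0 : 0 < α := hA.trans_le hα
  have h1 := one_add_cosh_pos hA θ
  have h2 := one_add_cosh_pos hα0 θ
  have hc := Real.one_le_cosh θ
  have e : condSq α θ - condSq A θ = 2 * Real.cosh θ * (α - A) /
      ((1 + 2 * α * Real.cosh θ) * (1 + 2 * A * Real.cosh θ)) := by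
    rw [condSq, condSq]; field_simp; ring
  rw [e, div_le_div_iff₀ (mul_pos h2 h1) hA]
  have h4 : 2 * Real.cosh θ * A ≤ (1 + 2 * α * Real.cosh θ) * (1 + 2 * A * Real.cosh θ) := by
    have : 0 ≤ 2 * α * Real.cosh θ := by positivity
    nlinarith
  nlinarith [sub_nonneg.2 hα]

/-- Together with `condSq_mono_weight` this makes the limiting variance an exact lower bound for the
conditional second moment at every `n`, as the anti-concentration argument needs. -/
lemma condSq_zero_le (hA : 0 < A) (θ : ℝ) : condSq A 0 ≤ condSq A θ := by
  have hc := Real.one_le_cosh θ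
  rw [condSq, condSq, div_le_div_iff₀ (one_add_cosh_pos hA 0) (one_add_cosh_pos hA θ),
    Real.cosh_zero]
  nlinarith

end Response

/-! ### Uniform bounds on conditional moments and on the force. -/

/-- The bounds on the single-site conditional distributions used in the Stein argument: `v` is the
limiting conditional variance, and `a x^(2k-1)` the leading term of the mean-field force. -/
structure SiteBounds (β K : ℝ) (k : ℕ) (v a a' C : ℝ) : Prop where
  one_le : 1 ≤ k
  v_pos : 0 < v
  a_pos : 0 < a
  a'_pos : 0 < a'
  C_nonneg : 0 ≤ C
  mean_le : ∀ {n : ℕ} (ω : Config n) (j : Fin n),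
    |siteMean β K ω j| ≤ C * (|totalSpin ω| + 1) / n
  mean_le_one : ∀ {n : ℕ} (ω : Config n) (j : Fin n), |siteMean β K ω j| ≤ 1
  var_sub_le : ∀ {n : ℕ} (ω : Config n) (j : Fin n),
    |siteSq β K ω j - siteMean β K ω j ^ 2 - v| ≤ C * (|totalSpin ω| + 1) / n
  le_sq : ∀ {n : ℕ} (ω : Config n) (j : Fin n), v ≤ siteSq β K ω j
  force_sub_le : ∀ {n : ℕ} (ω : Config n), 1 ≤ n →
    |totalSpin ω - ∑ j, siteMean β K ω j - n * (a * (totalSpin ω / n) ^ (2 * k - 1))| ≤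
      C * (1 + n * (totalSpin ω / n) ^ (2 * k))
  le_force : ∀ {n : ℕ} (ω : Config n), 1 ≤ n →
    a' * n ^ 2 * (totalSpin ω / n) ^ (2 * k) - C * |totalSpin ω| ≤
      totalSpin ω * (totalSpin ω - ∑ j, siteMean β K ω j)

lemma siteWeight_sub_div_le {β K : ℝ} (hβ : 0 < β) (hK : 0 < K) {n : ℕ} (hn : 1 ≤ n) :
    Real.exp (-β) ≤ siteWeight β K n ∧
      (siteWeight β K n - Real.exp (-β)) / Real.exp (-β) ≤
        β * K * Real.exp (β * K) * (1 / n) := by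
  have hn0 : (1 : ℝ) ≤ n := by exact_mod_cast hn
  set u := β * K / n with hu
  have hu0 : 0 ≤ u := by positivity
  have hu1 : u ≤ β * K := div_le_self (by positivity) hn0
  have e : siteWeight β K n = Real.exp (-β) * Real.exp u := by rw [siteWeight, Real.exp_add]
  have hA := Real.exp_pos (-β)
  rw [e]
  constructor
  · exact le_mul_of_one_le_right hA.le (Real.one_le_exp hu0)
  · have h2 : Real.exp u - 1 ≤ u * Real.exp u := by
      have h3 := Real.add_one_le_exp (-u)
      have h4 := mul_le_mul_of_nonneg_right h3 (Real.exp_pos u).le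
      rw [← Real.exp_add, neg_add_cancel, Real.exp_zero] at h4
      linarith
    calc (Real.exp (-β) * Real.exp u - Real.exp (-β)) / Real.exp (-β) = Real.exp u - 1 := by
          field_simp
      _ ≤ u * Real.exp u := h2
      _ ≤ u * Real.exp (β * K) := by gcongr
      _ = _ := by rw [hu]; ring

/-- Everything is compared with the limiting response at `S / n`. Passing from the weight at `n` to
`e^(-β)`, and from `S_j` to `S`, costs `O(1/n)` per site, hence `O(1)` in the force, while the force
itself has order `r`. -/
theorem exists_siteBounds {β K : ℝ} (hβ : 0 < β) (hK : 0 < K) {k : ℕ}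
    (h : IsCriticalOrder (Real.exp (-β)) (2 * β * K) k) :
    ∃ v a a' C : ℝ, SiteBounds β K k v a a' C := by
  set A := Real.exp (-β) with hAdef
  have hA : 0 < A := Real.exp_pos _
  set b := 2 * β * K with hb'
  have hb : 0 < b := by positivity
  set e := responseCoeff A b (k - 1) with he
  have he0 : 0 < e := h.pos
  set κ := β * K * Real.exp (β * K) with hκ
  have hκ0 : 0 < κ := by positivity
  set C₁ := responseNum A b 1 + e * (2 * A) * (b ^ 2 * Real.exp (b ^ 2)) with hC₁
  have hC₁0 : 0 ≤ C₁ := by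
    have := h.responseNum_one_nonneg
    positivity
  have hα := fun n => siteWeight_pos β K n
  have hother : ∀ {n : ℕ} (ω : Config n) (j : Fin n), |otherSpin ω j| ≤ |totalSpin ω| + 1 := by
    intro n ω j
    rw [otherSpin]
    exact (abs_sub _ _).trans (by linarith [abs_spin_le_one ω j])
  have hmean : ∀ {n : ℕ} (ω : Config n) (j : Fin n),
      |siteMean β K ω j| ≤ b * (|totalSpin ω| + 1) / n := by
    intro n ω j
    refine (abs_condMean_le (hα n) _).trans ?_
    rw [abs_mul, abs_of_pos hb, abs_div, Nat.abs_cast, mul_div_assoc]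
    gcongr
    exact hother ω j
  have hmean1 : ∀ {n : ℕ} (ω : Config n) (j : Fin n), |siteMean β K ω j| ≤ 1 :=
    fun {n} ω j => abs_condMean_le_one (hα n) _
  have hsum : ∀ {n : ℕ} (ω : Config n), 1 ≤ n →
      |(totalSpin ω - ∑ j, siteMean β K ω j) -
        n * (totalSpin ω / n - condMean A (b * (totalSpin ω / n)))| ≤ κ + b := by
    intro n ω hn
    have hn0 : (0 : ℝ) < n := by exact_mod_cast hn
    obtain ⟨hw1, hw2⟩ := siteWeight_sub_div_le hβ hK hn
    have hj : ∀ j, |siteMean β K ω j - condMean A (b * (totalSpin ω / n))| ≤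
        (κ + b) * (1 / n) := by
      intro j
      have h1 := abs_condMean_weight_sub_le hA hw1 (b * (otherSpin ω j / n))
      have h2 := abs_condMean_sub_le hA (b * (otherSpin ω j / n)) (b * (totalSpin ω / n))
      have h3 : |b * (otherSpin ω j / n) - b * (totalSpin ω / n)| ≤ b * (1 / n) := by
        have : b * (otherSpin ω j / n) - b * (totalSpin ω / n) = -(b * (spin ω j / n)) := by
          rw [otherSpin]; ring
        rw [this, abs_neg, abs_mul, abs_of_pos hb, abs_div, Nat.abs_cast]
        gcongr
        exact abs_spin_le_one ω j
      have h4 := abs_sub_le (siteMean β K ω j) (condMean A (b * (otherSpin ω j / n)))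
        (condMean A (b * (totalSpin ω / n)))
      have h5 : |siteMean β K ω j - condMean A (b * (otherSpin ω j / n))| ≤ κ * (1 / n) :=
        h1.trans hw2
      linarith
    have e1 : (totalSpin ω - ∑ j, siteMean β K ω j) -
        n * (totalSpin ω / n - condMean A (b * (totalSpin ω / n))) =
        -∑ j, (siteMean β K ω j - condMean A (b * (totalSpin ω / n))) := by
      rw [Finset.sum_sub_distrib, Finset.sum_const, Finset.card_univ, Fintype.card_fin,
        nsmul_eq_mul]
      field_simp
      ring
    rw [e1, abs_neg]
    refine (Finset.abs_sum_le_sum_abs _ _).trans ((Finset.sum_le_sum fun j _ => hj j).trans ?_)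
    rw [Finset.sum_const, Finset.card_univ, Fintype.card_fin, nsmul_eq_mul]
    apply le_of_eq
    field_simp
  have hx1 : ∀ {n : ℕ} (ω : Config n), 1 ≤ n → |totalSpin ω / n| ≤ 1 := by
    intro n ω hn
    have hn0 : (0 : ℝ) < n := by exact_mod_cast hn
    rw [abs_div, Nat.abs_cast, div_le_one hn0]
    exact abs_totalSpin_le ω
  -- The variance `v` is the second moment at zero field, where the mean vanishes. The constant `a`
  -- uses the denominator at `0`, and `a'` the largest denominator on `[-1, 1]`.
  refine ⟨condSq A 0, e / (1 + 2 * A), e / (1 + 2 * A * Real.cosh b), 2 * b + κ + C₁,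
    ⟨h.one_le, ?_, by positivity, ?_, by positivity, fun {n} ω j => ?_, hmean1, fun {n} ω j => ?_,
      fun {n} ω j => ?_, fun {n} ω hn => ?_, fun {n} ω hn => ?_⟩⟩
  · rw [condSq, Real.cosh_zero]; positivity
  · exact div_pos he0 (one_add_cosh_pos hA b)
  · refine (hmean ω j).trans ?_
    gcongr
    linarith
  · have hn : 1 ≤ n := j.pos
    have hn0 : (0 : ℝ) < n := by exact_mod_cast hn
    obtain ⟨hw1, hw2⟩ := siteWeight_sub_div_le hβ hK hn
    have hS := abs_nonneg (totalSpin ω)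
    have h1 : |siteSq β K ω j - condSq A (b * (otherSpin ω j / n))| ≤ κ * (1 / n) := by
      rw [siteSq, abs_of_nonneg (sub_nonneg.2 (condSq_mono_weight hA hw1 _))]
      exact (condSq_weight_sub_le hA hw1 _).trans hw2
    have h2 : |condSq A (b * (otherSpin ω j / n)) - condSq A 0| ≤
        b * (|totalSpin ω| + 1) / n := by
      refine (abs_condSq_sub_le hA _ _).trans ?_
      rw [sub_zero, abs_mul, abs_of_pos hb, abs_div, Nat.abs_cast, mul_div_assoc]
      gcongr
      exact hother ω j
    -- One factor is bounded by `1`, so the square inherits the linear bound on the mean.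
    have h3 : siteMean β K ω j ^ 2 ≤ b * (|totalSpin ω| + 1) / n := by
      rw [← sq_abs]
      nlinarith [hmean ω j, hmean1 ω j, abs_nonneg (siteMean β K ω j)]
    have h4 : κ * (1 / n) ≤ κ * (|totalSpin ω| + 1) / n := by
      rw [mul_div_assoc]; gcongr; linarith
    have h5 : 0 ≤ C₁ * (|totalSpin ω| + 1) / n := by positivity
    have h6 : (2 * b + κ + C₁) * (|totalSpin ω| + 1) / n = b * (|totalSpin ω| + 1) / n +
        b * (|totalSpin ω| + 1) / n + κ * (|totalSpin ω| + 1) / n +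
        C₁ * (|totalSpin ω| + 1) / n := by ring
    rw [h6]
    have h7 := abs_le.1 h1
    have h8 := abs_le.1 h2
    have h9 := sq_nonneg (siteMean β K ω j)
    rw [abs_le]
    constructor <;> linarith [h7.1, h7.2, h8.1, h8.2]
  · obtain ⟨hw1, -⟩ := siteWeight_sub_div_le hβ hK (j.pos : 1 ≤ n)
    exact (condSq_zero_le hA _).trans (condSq_mono_weight hA hw1 _)
  · have hn0 : (0 : ℝ) < n := by exact_mod_cast hn
    have h1 := hsum ω hn
    have h2 := h.abs_sub_condMean_sub_le hA hb (hx1 ω hn)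
    set x := totalSpin ω / n
    have hx0 : 0 ≤ x ^ (2 * k) := (even_two_mul k).pow_nonneg _
    have h3 : |n * (x - condMean A (b * x)) - n * (e / (1 + 2 * A) * x ^ (2 * k - 1))| ≤
        C₁ * (n * x ^ (2 * k)) := by
      rw [← mul_sub, abs_mul, Nat.abs_cast]
      calc _ ≤ n * (C₁ * x ^ (2 * k)) := by gcongr
        _ = _ := by ring
    have h4 := abs_sub_le (totalSpin ω - ∑ j, siteMean β K ω j) (n * (x - condMean A (b * x)))
      (n * (e / (1 + 2 * A) * x ^ (2 * k - 1)))
    have h5 : 0 ≤ (2 * b + κ) * (n * x ^ (2 * k)) := by positivity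
    nlinarith
  · have hn0 : (0 : ℝ) < n := by exact_mod_cast hn
    have h1 := hsum ω hn
    have h2 := h.le_mul_sub_condMean hA (hx1 ω hn)
    set S := totalSpin ω
    set x := S / n with hx
    have hSx : S = n * x := by rw [hx]; field_simp
    have h4 : |S * ((S - ∑ j, siteMean β K ω j) - n * (x - condMean A (b * x)))| ≤
        (2 * b + κ + C₁) * |S| := by
      rw [abs_mul, mul_comm]
      gcongr
      linarith
    have h5 : n ^ 2 * (e / (1 + 2 * A * Real.cosh b) * x ^ (2 * k)) ≤
        n ^ 2 * (x * (x - condMean A (b * x))) := by gcongr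
    have h6 : S * (n * (x - condMean A (b * x))) = n ^ 2 * (x * (x - condMean A (b * x))) := by
      rw [hSx]; ring
    have h7 := (abs_le.1 h4).1
    rw [mul_sub, h6] at h7
    linarith


/-! ### Rescaling and expectations under the Gibbs measure. -/

/-- `r = n^(1/(2k))` for some `n ≥ 1`. -/
structure IsScale (k n : ℕ) (r : ℝ) : Prop where
  one_le_n : 1 ≤ n
  one_le_r : 1 ≤ r
  pow_eq : r ^ (2 * k) = n

/-- The total spin rescaled by `r^(2k-1)`, which is `n^(1-1/(2k))` when `IsScale k n r`. -/
noncomputable def scaledSpin (k : ℕ) (r : ℝ) {n : ℕ} (ω : Config n) : ℝ :=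
  totalSpin ω / r ^ (2 * k - 1)

section GibbsMean

variable {n : ℕ} (β K : ℝ)

lemma integral_gibbs_mono {φ ψ : Config n → ℝ} (h : ∀ ω, φ ω ≤ ψ ω) :
    ∫ ω, φ ω ∂(gibbs β K n) ≤ ∫ ω, ψ ω ∂(gibbs β K n) :=
  integral_mono (gibbs_integrable _ _ _) (gibbs_integrable _ _ _) h

lemma integral_gibbs_add (φ ψ : Config n → ℝ) :
    ∫ ω, (φ ω + ψ ω) ∂(gibbs β K n) =
      ∫ ω, φ ω ∂(gibbs β K n) + ∫ ω, ψ ω ∂(gibbs β K n) :=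
  integral_add (gibbs_integrable _ _ _) (gibbs_integrable _ _ _)

lemma integral_gibbs_sub (φ ψ : Config n → ℝ) :
    ∫ ω, (φ ω - ψ ω) ∂(gibbs β K n) =
      ∫ ω, φ ω ∂(gibbs β K n) - ∫ ω, ψ ω ∂(gibbs β K n) :=
  integral_sub (gibbs_integrable _ _ _) (gibbs_integrable _ _ _)

lemma integral_gibbs_const (c : ℝ) : ∫ _ω : Config n, c ∂(gibbs β K n) = c := by simp

lemma abs_integral_gibbs_le {φ χ : Config n → ℝ} (h : ∀ ω, |φ ω| ≤ χ ω) :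
    |∫ ω, φ ω ∂(gibbs β K n)| ≤ ∫ ω, χ ω ∂(gibbs β K n) :=
  (abs_integral_le_integral_abs).trans (integral_gibbs_mono β K h)

lemma abs_integral_gibbs_sub_le {φ ψ χ : Config n → ℝ} (h : ∀ ω, |φ ω - ψ ω| ≤ χ ω) :
    |∫ ω, φ ω ∂(gibbs β K n) - ∫ ω, ψ ω ∂(gibbs β K n)| ≤ ∫ ω, χ ω ∂(gibbs β K n) := by
  rw [← integral_gibbs_sub]
  exact abs_integral_gibbs_le β K h

lemma abs_sum_le_card_mul {f : Fin n → ℝ} {B : ℝ} (h : ∀ j, |f j| ≤ B) :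
    |∑ j, f j| ≤ n * B := by
  refine (Finset.abs_sum_le_sum_abs _ _).trans ((Finset.sum_le_sum fun j _ => h j).trans ?_)
  simp

/-- The conditional variance identity. -/
lemma integral_spin_mul_spin_sub_mul (j : Fin n) (q : ℝ → ℝ) :
    ∫ ω, spin ω j * (spin ω j - siteMean β K ω j) * q (otherSpin ω j) ∂(gibbs β K n) =
      ∫ ω, (siteSq β K ω j - siteMean β K ω j ^ 2) * q (otherSpin ω j) ∂(gibbs β K n) := by
  have h1 := integral_spin_sq_mul β K j q
  have h2 := integral_spin_mul β K j fun s =>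
    condMean (siteWeight β K n) (2 * β * K * (s / n)) * q s
  have e1 : ∀ ω : Config n, spin ω j * (spin ω j - siteMean β K ω j) * q (otherSpin ω j) =
      spin ω j ^ 2 * q (otherSpin ω j) - spin ω j *
        (condMean (siteWeight β K n) (2 * β * K * (otherSpin ω j / n)) * q (otherSpin ω j)) := by
    intro ω; rw [siteMean]; ring
  have e2 : ∀ ω : Config n, (siteSq β K ω j - siteMean β K ω j ^ 2) * q (otherSpin ω j) =
      condSq (siteWeight β K n) (2 * β * K * (otherSpin ω j / n)) * q (otherSpin ω j) -
      condMean (siteWeight β K n) (2 * β * K * (otherSpin ω j / n)) *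
        (condMean (siteWeight β K n) (2 * β * K * (otherSpin ω j / n)) * q (otherSpin ω j)) := by
    intro ω; rw [siteMean, siteSq]; ring
  simp only [e1, e2, integral_gibbs_sub, h1, h2]

end GibbsMean

lemma abs_pow_le_one_add {k m : ℕ} (hm : m ≤ 2 * k) (w : ℝ) : |w| ^ m ≤ 1 + w ^ (2 * k) := by
  have h0 : 0 ≤ w ^ (2 * k) := (even_two_mul k).pow_nonneg _
  rcases le_total |w| 1 with h | h
  · linarith [pow_le_one₀ (abs_nonneg w) h (n := m)]
  · have := pow_le_pow_right₀ h hm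
    rw [(even_two_mul k).pow_abs] at this
    linarith

lemma abs_le_one_add_pow {k : ℕ} (hk : 1 ≤ k) (w : ℝ) : |w| ≤ 1 + w ^ (2 * k) := by
  simpa using abs_pow_le_one_add (k := k) (m := 1) (by omega) w

section Scale

variable {k n : ℕ} {r : ℝ}

lemma IsScale.r_pos (h : IsScale k n r) : 0 < r := zero_lt_one.trans_le h.one_le_r

lemma IsScale.n_pos (h : IsScale k n r) : (0 : ℝ) < n := by
  exact_mod_cast h.one_le_n

lemma IsScale.eq_mul (h : IsScale k n r) (hk : 1 ≤ k) : (n : ℝ) = r * r ^ (2 * k - 1) := by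
  rw [← h.pow_eq, ← pow_succ']; congr 1; omega

lemma IsScale.le_pow (h : IsScale k n r) (hk : 1 ≤ k) : r ≤ r ^ (2 * k - 1) :=
  le_self_pow₀ h.one_le_r (by omega)

lemma IsScale.sq_le (h : IsScale k n r) (hk : 1 ≤ k) : r * r ≤ n := by
  rw [h.eq_mul hk]
  exact mul_le_mul_of_nonneg_left (h.le_pow hk) h.r_pos.le

lemma IsScale.totalSpin_eq (h : IsScale k n r) (ω : Config n) :
    totalSpin ω = scaledSpin k r ω * r ^ (2 * k - 1) := by
  have := h.r_pos
  rw [scaledSpin]; field_simp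

lemma IsScale.totalSpin_div (h : IsScale k n r) (hk : 1 ≤ k) (ω : Config n) :
    totalSpin ω / n = scaledSpin k r ω / r := by
  have := h.r_pos
  rw [h.totalSpin_eq ω, h.eq_mul hk]; field_simp

lemma IsScale.mul_div_pow (h : IsScale k n r) (hk : 1 ≤ k) (ω : Config n) :
    n * (totalSpin ω / n) ^ (2 * k) = scaledSpin k r ω ^ (2 * k) := by
  have h1 := h.n_pos.ne'
  rw [h.totalSpin_div hk, div_pow, h.pow_eq]; field_simp

lemma IsScale.mul_div_pow_sub_one (h : IsScale k n r) (hk : 1 ≤ k) (ω : Config n) :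
    n * (totalSpin ω / n) ^ (2 * k - 1) = r * scaledSpin k r ω ^ (2 * k - 1) := by
  have h1 := h.r_pos.ne'
  rw [h.totalSpin_div hk, div_pow, h.eq_mul hk]; field_simp

lemma IsScale.abs_totalSpin_add_one_div (h : IsScale k n r) (hk : 1 ≤ k) (ω : Config n) :
    (|totalSpin ω| + 1) / n ≤ (|scaledSpin k r ω| + 1) / r := by
  have h1 := h.r_pos
  have h2 := h.n_pos
  have h3 : |totalSpin ω| / n = |scaledSpin k r ω| / r := by
    have := congrArg abs (h.totalSpin_div hk ω)
    rwa [abs_div, abs_div, Nat.abs_cast, abs_of_pos h1] at this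
  rw [add_div, add_div, h3]
  have h4 : r ≤ n := (le_mul_of_one_le_left h1.le h.one_le_r).trans (h.sq_le hk)
  gcongr

end Scale

/-! ### Moment bounds and anti-concentration. -/

section Estimates

variable {β K : ℝ} {k : ℕ} {v a a' C : ℝ} {n : ℕ} {r : ℝ}

lemma SiteBounds.scaled_mean_le (sb : SiteBounds β K k v a a' C) (hs : IsScale k n r)
    (ω : Config n) (j : Fin n) :
    |siteMean β K ω j| ≤ C * (2 + scaledSpin k r ω ^ (2 * k)) / r := by
  refine (sb.mean_le ω j).trans ?_
  rw [mul_div_assoc, mul_div_assoc]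
  refine mul_le_mul_of_nonneg_left ((hs.abs_totalSpin_add_one_div sb.one_le ω).trans ?_) sb.C_nonneg
  refine div_le_div_of_nonneg_right ?_ hs.r_pos.le
  linarith [abs_le_one_add_pow sb.one_le (scaledSpin k r ω)]

lemma SiteBounds.scaled_var_sub_le (sb : SiteBounds β K k v a a' C) (hs : IsScale k n r)
    (ω : Config n) (j : Fin n) :
    |siteSq β K ω j - siteMean β K ω j ^ 2 - v| ≤ C * (2 + scaledSpin k r ω ^ (2 * k)) / r := by
  refine (sb.var_sub_le ω j).trans ?_
  rw [mul_div_assoc, mul_div_assoc]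
  refine mul_le_mul_of_nonneg_left ((hs.abs_totalSpin_add_one_div sb.one_le ω).trans ?_) sb.C_nonneg
  refine div_le_div_of_nonneg_right ?_ hs.r_pos.le
  linarith [abs_le_one_add_pow sb.one_le (scaledSpin k r ω)]

lemma SiteBounds.scaled_force_sub_le (sb : SiteBounds β K k v a a' C) (hs : IsScale k n r)
    (ω : Config n) : |totalSpin ω - ∑ j, siteMean β K ω j -
      r * a * scaledSpin k r ω ^ (2 * k - 1)| ≤ C * (1 + scaledSpin k r ω ^ (2 * k)) := by
  have h := sb.force_sub_le ω hs.one_le_n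
  rw [hs.mul_div_pow sb.one_le, mul_left_comm, hs.mul_div_pow_sub_one sb.one_le] at h
  rwa [mul_comm r a, mul_assoc]

lemma SiteBounds.scaled_le_force (sb : SiteBounds β K k v a a' C) (hs : IsScale k n r)
    (ω : Config n) : a' * n * scaledSpin k r ω ^ (2 * k) - C * |totalSpin ω| ≤
      totalSpin ω * (totalSpin ω - ∑ j, siteMean β K ω j) := by
  have h := sb.le_force ω hs.one_le_n
  rw [← hs.mul_div_pow sb.one_le]
  calc _ = _ := by ring
    _ ≤ _ := h

lemma abs_spin_sub_siteMean_le (sb : SiteBounds β K k v a a' C) (ω : Config n) (j : Fin n) :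
    |spin ω j - siteMean β K ω j| ≤ 2 :=
  (abs_sub _ _).trans (by linarith [abs_spin_le_one ω j, sb.mean_le_one ω j])

/-- Bound for the `2k`-th moment. -/
lemma SiteBounds.moment_le (sb : SiteBounds β K k v a a' C) (hs : IsScale k n r) :
    ∫ ω : Config n, scaledSpin k r ω ^ (2 * k) ∂(gibbs β K n) ≤ (2 + C) / a' := by
  have h1 := integral_mul_totalSpin_sub (n := n) β K fun s => s
  have hn := hs.n_pos
  have ha' := sb.a'_pos
  -- For the test function `g(s) = s` a site term is `ω_j (ω_j - m_j)`, at most `2`. Coercivity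
  -- bounds the other side below by `a' n W^(2k) - C|S|`, and `|S| ≤ n` suffices.
  have h2 : ∀ j : Fin n, |∫ ω, (totalSpin ω - otherSpin ω j) * (spin ω j - siteMean β K ω j)
      ∂(gibbs β K n)| ≤ 2 := by
    intro j
    refine (abs_integral_gibbs_le β K (χ := fun _ => 2) fun ω => ?_).trans_eq
      (integral_gibbs_const _ _ _)
    have e : totalSpin ω - otherSpin ω j = spin ω j := by rw [otherSpin]; ring
    rw [e, abs_mul]
    calc _ ≤ 1 * 2 := mul_le_mul (abs_spin_le_one ω j) (abs_spin_sub_siteMean_le sb ω j)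
          (abs_nonneg _) zero_le_one
      _ = 2 := one_mul 2
  have h3 := (le_abs_self _).trans (abs_sum_le_card_mul h2)
  rw [← h1] at h3
  have h4 := integral_gibbs_mono β K (φ := fun ω : Config n =>
    a' * n * scaledSpin k r ω ^ (2 * k) - C * n) fun ω => le_trans (by
      have := mul_le_mul_of_nonneg_left (abs_totalSpin_le ω) sb.C_nonneg
      linarith) (sb.scaled_le_force hs ω)
  rw [integral_gibbs_sub, integral_const_mul, integral_gibbs_const] at h4
  rw [le_div_iff₀ ha']
  refine le_of_mul_le_mul_left ?_ hn
  linarith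

/-- Bound for the `(2k+2)`-th moment. -/
lemma SiteBounds.moment_add_two_le (sb : SiteBounds β K k v a a' C) (hs : IsScale k n r) :
    ∫ ω : Config n, scaledSpin k r ω ^ (2 * k + 2) ∂(gibbs β K n) ≤
      (14 + C) * ((2 + C) / a' + 2) / a' := by
  -- With the cubic test function both sides scale like `n R²`, and the `2k`-th moment already
  -- obtained controls the site terms.
  have h1 := integral_mul_totalSpin_sub (n := n) β K fun s => s ^ 3
  have hn := hs.n_pos
  have ha' := sb.a'_pos
  have hC := sb.C_nonneg
  set R := r ^ (2 * k - 1) with hR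
  have hR1 : 1 ≤ R := one_le_pow₀ hs.one_le_r
  have hsq : ∀ ω : Config n, totalSpin ω ^ 2 + 1 ≤ R ^ 2 * (scaledSpin k r ω ^ (2 * k) + 2) := by
    intro ω
    have h2 := abs_pow_le_one_add (k := k) (m := 2) (by have := sb.one_le; omega)
      (scaledSpin k r ω)
    rw [sq_abs] at h2
    rw [hs.totalSpin_eq ω, mul_pow, ← hR]
    have h3 : 1 ≤ R ^ 2 := one_le_pow₀ hR1
    nlinarith
  have hm := sb.moment_le hs
  set m := ∫ ω : Config n, scaledSpin k r ω ^ (2 * k) ∂(gibbs β K n) with hmdef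
  have h2 : ∀ j : Fin n, |∫ ω, (totalSpin ω ^ 3 - otherSpin ω j ^ 3) *
      (spin ω j - siteMean β K ω j) ∂(gibbs β K n)| ≤ 14 * (R ^ 2 * (m + 2)) := by
    intro j
    refine (abs_integral_gibbs_le β K (χ := fun ω =>
      14 * (R ^ 2 * (scaledSpin k r ω ^ (2 * k) + 2))) fun ω => ?_).trans_eq ?_
    · have h3 := abs_spin_sub_siteMean_le sb ω j
      have h4 : |totalSpin ω ^ 3 - otherSpin ω j ^ 3| ≤ 7 * (totalSpin ω ^ 2 + 1) := by
        have e : totalSpin ω ^ 3 - otherSpin ω j ^ 3 = spin ω j *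
            (3 * totalSpin ω ^ 2 - 3 * totalSpin ω * spin ω j + spin ω j ^ 2) := by
          rw [otherSpin]; ring
        rw [e, abs_mul]
        have h5 := abs_spin_le_one ω j
        have h6 := spin_sq_le_one ω j
        have h7 : |3 * totalSpin ω ^ 2 - 3 * totalSpin ω * spin ω j + spin ω j ^ 2| ≤
            7 * (totalSpin ω ^ 2 + 1) := by
          rw [abs_le]
          constructor <;> nlinarith [sq_nonneg (totalSpin ω - spin ω j),
            sq_nonneg (totalSpin ω + spin ω j), sq_nonneg (totalSpin ω), sq_nonneg (spin ω j)]
        calc _ ≤ 1 * (7 * (totalSpin ω ^ 2 + 1)) :=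
              mul_le_mul h5 h7 (abs_nonneg _) zero_le_one
          _ = _ := one_mul _
      rw [abs_mul]
      calc _ ≤ 7 * (totalSpin ω ^ 2 + 1) * 2 := by gcongr
        _ = 14 * (totalSpin ω ^ 2 + 1) := by ring
        _ ≤ _ := by gcongr; exact hsq ω
    · rw [integral_const_mul, integral_const_mul, integral_gibbs_add, integral_gibbs_const]
  have h3 := (le_abs_self _).trans (abs_sum_le_card_mul h2)
  rw [← h1] at h3
  have h4 := integral_gibbs_mono β K (φ := fun ω : Config n =>
    a' * n * R ^ 2 * scaledSpin k r ω ^ (2 * k + 2) -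
      C * n * (R ^ 2 * (scaledSpin k r ω ^ (2 * k) + 2)))
      (ψ := fun ω => totalSpin ω ^ 3 * (totalSpin ω - ∑ j, siteMean β K ω j)) fun ω => by
    have h5 := mul_le_mul_of_nonneg_left (sb.scaled_le_force hs ω) (sq_nonneg (totalSpin ω))
    have e1 : a' * n * R ^ 2 * scaledSpin k r ω ^ (2 * k + 2) =
        totalSpin ω ^ 2 * (a' * n * scaledSpin k r ω ^ (2 * k)) := by
      rw [hs.totalSpin_eq ω, ← hR]; ring
    have h6 : C * (totalSpin ω ^ 2 * |totalSpin ω|) ≤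
        C * n * (R ^ 2 * (scaledSpin k r ω ^ (2 * k) + 2)) := by
      rw [mul_assoc C]
      refine mul_le_mul_of_nonneg_left ?_ hC
      have h7 := mul_le_mul_of_nonneg_left (abs_totalSpin_le ω) (sq_nonneg (totalSpin ω))
      have h8 := mul_le_mul_of_nonneg_left (hsq ω) hn.le
      nlinarith
    calc _ ≤ totalSpin ω ^ 2 * (a' * n * scaledSpin k r ω ^ (2 * k) - C * |totalSpin ω|) := by
          rw [e1]; linarith
      _ ≤ _ := h5
      _ = _ := by ring
  rw [integral_gibbs_sub, integral_const_mul, integral_const_mul, integral_const_mul,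
    integral_gibbs_add, integral_gibbs_const] at h4
  rw [le_div_iff₀ ha']
  have hnR : 0 < n * R ^ 2 := by positivity
  refine le_of_mul_le_mul_left ?_ hnR
  have h5 : n * R ^ 2 * ((14 + C) * (m + 2)) ≤ n * R ^ 2 * ((14 + C) * ((2 + C) / a' + 2)) := by
    gcongr
  linarith

/-- The `2k`-th moment converges at rate `1/r`. -/
lemma SiteBounds.exists_moment_sub_le (sb : SiteBounds β K k v a a' C) :
    ∃ C₃ : ℝ, 0 ≤ C₃ ∧ ∀ (n : ℕ) (r : ℝ), IsScale k n r →
      |a * ∫ ω : Config n, scaledSpin k r ω ^ (2 * k) ∂(gibbs β K n) - v| ≤ C₃ / r := by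
  have ha' := sb.a'_pos
  have hC := sb.C_nonneg
  set M := (2 + C) / a' with hM
  set M' := (14 + C) * ((2 + C) / a' + 2) / a' with hM'
  refine ⟨C * (2 + M) + C * (1 + 3 * M + M'), by positivity, fun n r hs => ?_⟩
  have hn := hs.n_pos
  have hr := hs.r_pos
  have h1 := integral_mul_totalSpin_sub (n := n) β K fun s => s
  have hm := sb.moment_le hs
  have hm' := sb.moment_add_two_le hs
  set m := ∫ ω : Config n, scaledSpin k r ω ^ (2 * k) ∂(gibbs β K n) with hmdef
  -- Again `g(s) = s`, but each site term is now evaluated to leading order: its expectation is that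
  -- of the conditional variance, hence close to `v`.
  have h2 : ∀ j : Fin n, |∫ ω, (totalSpin ω - otherSpin ω j) *
      (spin ω j - siteMean β K ω j) ∂(gibbs β K n) - v| ≤ C * (2 + M) / r := by
    intro j
    have e1 : ∫ ω, (totalSpin ω - otherSpin ω j) * (spin ω j - siteMean β K ω j) ∂(gibbs β K n)
        = ∫ ω, (siteSq β K ω j - siteMean β K ω j ^ 2) ∂(gibbs β K n) := by
      have := integral_spin_mul_spin_sub_mul β K j fun _ => 1
      simp only [mul_one] at this
      rw [← this]
      congr 1; funext ω; rw [otherSpin]; ring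
    rw [e1, ← integral_gibbs_const (n := n) β K v]
    refine (abs_integral_gibbs_sub_le β K (χ := fun ω =>
      C * (2 + scaledSpin k r ω ^ (2 * k)) / r) fun ω => sb.scaled_var_sub_le hs ω j).trans ?_
    rw [integral_div, integral_const_mul, integral_gibbs_add, integral_gibbs_const]
    gcongr
  have h3 : |∑ j : Fin n, (∫ ω, (totalSpin ω - otherSpin ω j) *
      (spin ω j - siteMean β K ω j) ∂(gibbs β K n) - v)| ≤ n * (C * (2 + M) / r) :=
    abs_sum_le_card_mul h2
  rw [Finset.sum_sub_distrib, ← h1, Finset.sum_const, Finset.card_univ, Fintype.card_fin,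
    nsmul_eq_mul] at h3
  have h4 : |∫ ω : Config n, totalSpin ω * (totalSpin ω - ∑ j, siteMean β K ω j) ∂(gibbs β K n) -
      ∫ ω : Config n, a * n * scaledSpin k r ω ^ (2 * k) ∂(gibbs β K n)| ≤
      n / r * (C * (1 + 3 * M + M')) := by
    refine (abs_integral_gibbs_sub_le β K (χ := fun ω =>
      n / r * (C * (1 + 3 * scaledSpin k r ω ^ (2 * k) + scaledSpin k r ω ^ (2 * k + 2))))
      fun ω => ?_).trans ?_
    · have h5 := sb.scaled_force_sub_le hs ω
      set w := scaledSpin k r ω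
      have hnR : (n : ℝ) / r = r ^ (2 * k - 1) := by
        rw [hs.eq_mul sb.one_le]; field_simp
      have e2 : totalSpin ω * (totalSpin ω - ∑ j, siteMean β K ω j) - a * n * w ^ (2 * k) =
          totalSpin ω * (totalSpin ω - ∑ j, siteMean β K ω j - r * a * w ^ (2 * k - 1)) := by
        have e3 : w ^ (2 * k) = w * w ^ (2 * k - 1) := by
          rw [← pow_succ']; congr 1; have := sb.one_le; omega
        rw [mul_sub, hs.totalSpin_eq ω, hs.eq_mul sb.one_le, e3]
        ring
      have e4 : |totalSpin ω| = n / r * |w| := by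
        rw [hs.totalSpin_eq ω, abs_mul, abs_of_nonneg (by positivity : 0 ≤ r ^ (2 * k - 1)), hnR,
          mul_comm]
      rw [e2, abs_mul, e4, mul_assoc]
      have hw0 : 0 ≤ w ^ (2 * k) := (even_two_mul k).pow_nonneg _
      -- The error contains `|w|^(2k+1)`; bounding it by even powers is what requires the moment of
      -- order `2k + 2`.
      have h6 : |w| * (1 + w ^ (2 * k)) ≤ 1 + 3 * w ^ (2 * k) + w ^ (2 * k + 2) := by
        have h7 := abs_le_one_add_pow sb.one_le w
        have h8 : |w| ≤ 1 + w ^ 2 := by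
          simpa using abs_le_one_add_pow (le_refl 1) w
        have h9 := mul_le_mul_of_nonneg_right h8 hw0
        have e5 : w ^ (2 * k + 2) = w ^ 2 * w ^ (2 * k) := by ring
        rw [e5]; linarith
      refine mul_le_mul_of_nonneg_left ?_ (by positivity)
      calc _ ≤ |w| * (C * (1 + w ^ (2 * k))) := by gcongr
        _ = C * (|w| * (1 + w ^ (2 * k))) := by ring
        _ ≤ _ := by gcongr
    · rw [integral_const_mul, integral_const_mul, integral_gibbs_add, integral_gibbs_add,
        integral_gibbs_const, integral_const_mul]
      gcongr
  rw [integral_const_mul] at h4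
  have h5 := abs_le.1 h3
  have h6 := abs_le.1 h4
  have e6 : n * (C * (2 + M) / r) = n * ((C * (2 + M)) / r) := rfl
  have e7 : n / r * (C * (1 + 3 * M + M')) = n * (C * (1 + 3 * M + M') / r) := by ring
  rw [e7] at h6
  rw [add_div, abs_le]
  constructor
  · refine le_of_mul_le_mul_left ?_ hn
    linarith [h5.1, h5.2, h6.1, h6.2]
  · refine le_of_mul_le_mul_left ?_ hn
    linarith [h5.1, h5.2, h6.1, h6.2]

/-- If `t` is within `3` of `y`, then `s` is within `4`, so no clipping occurs and the product is
the square. Elsewhere monotonicity of the clip makes the product nonnegative. -/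
lemma clip_sub_mul_ge (y s t : ℝ) (hst : |s - t| ≤ 1) :
    (if |t - y| ≤ 3 then (s - t) ^ 2 else 0) ≤
      (max (-4) (min (s - y) 4) - max (-4) (min (t - y) 4)) * (s - t) := by
  have hst' := abs_le.1 hst
  split_ifs with h
  · have h' := abs_le.1 h
    rw [min_eq_left (by linarith), min_eq_left (by linarith), max_eq_right (by linarith),
      max_eq_right (by linarith)]
    apply le_of_eq; ring
  · rcases le_total s t with h1 | h1
    · refine mul_nonneg_of_nonpos_of_nonpos (sub_nonpos.2 ?_) (sub_nonpos.2 h1)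
      gcongr
    · refine mul_nonneg (sub_nonneg.2 ?_) (sub_nonneg.2 h1)
      gcongr

lemma abs_clip_sub_le (y s t : ℝ) :
    |max (-4) (min (s - y) 4) - max (-4) (min (t - y) 4)| ≤ |s - t| := by
  have h1 := abs_max_sub_max_le_abs (min (s - y) 4) (min (t - y) 4) (-4)
  have h2 := abs_min_sub_min_le_max (s - y) 4 (t - y) 4
  rw [sub_self, abs_zero, max_eq_left (abs_nonneg _), sub_sub_sub_cancel_right] at h2
  rw [max_comm (-4), max_comm (-4)]
  exact h1.trans h2

/-- Anti-concentration: short windows have probability `O(1/r)`. -/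
lemma SiteBounds.exists_concentration (sb : SiteBounds β K k v a a' C) :
    ∃ C₄ : ℝ, 0 ≤ C₄ ∧ ∀ (n : ℕ) (r : ℝ), IsScale k n r → ∀ y : ℝ,
      ∫ ω : Config n, (if |totalSpin ω - y| ≤ 2 then 1 else 0) ∂(gibbs β K n) ≤ C₄ / r := by
  have ha' := sb.a'_pos
  have ha := sb.a_pos
  have hv := sb.v_pos
  have hC := sb.C_nonneg
  set M := (2 + C) / a' with hM
  refine ⟨(C * (2 + M) + 4 * (a + C) * (1 + M)) / v, by positivity, fun n r hs y => ?_⟩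
  have hn := hs.n_pos
  have hr := hs.r_pos
  -- The function is bounded by `4` and the force has order `r`, so the left side of the identity is
  -- `O(r)`. The right side is at least `n (v P - O(1/r))`, and `r² ≤ n` gives `P = O(1/r)`. The
  -- half-widths `2`, `3`, `4` for `S`, `S_j` and the clip leave one unit for each change of a spin.
  set g : ℝ → ℝ := fun s => max (-4) (min (s - y) 4) with hg
  have h1 := integral_mul_totalSpin_sub (n := n) β K g
  have hm := sb.moment_le hs
  set m := ∫ ω : Config n, scaledSpin k r ω ^ (2 * k) ∂(gibbs β K n) with hmdef
  set P := ∫ ω : Config n, (if |totalSpin ω - y| ≤ 2 then (1 : ℝ) else 0) ∂(gibbs β K n) with hP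
  have hlow : ∀ j : Fin n, v * P - C * (2 + M) / r ≤
      ∫ ω, (g (totalSpin ω) - g (otherSpin ω j)) * (spin ω j - siteMean β K ω j)
        ∂(gibbs β K n) := by
    intro j
    have h2 := integral_gibbs_mono β K (n := n)
      (φ := fun ω => spin ω j ^ 2 * (if |otherSpin ω j - y| ≤ 3 then 1 else 0) -
        C * (2 + scaledSpin k r ω ^ (2 * k)) / r)
      (ψ := fun ω => (g (totalSpin ω) - g (otherSpin ω j)) * (spin ω j - siteMean β K ω j))
      fun ω => by
        have e : totalSpin ω - otherSpin ω j = spin ω j := by rw [otherSpin]; ring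
        have hsp := abs_spin_le_one ω j
        have h3 := clip_sub_mul_ge y (totalSpin ω) (otherSpin ω j) (by rw [e]; exact hsp)
        have h4 := abs_clip_sub_le y (totalSpin ω) (otherSpin ω j)
        rw [e] at h3 h4
        have h5 := sb.scaled_mean_le hs ω j
        have h6 : |(g (totalSpin ω) - g (otherSpin ω j)) * siteMean β K ω j| ≤
            C * (2 + scaledSpin k r ω ^ (2 * k)) / r := by
          rw [abs_mul]
          calc _ ≤ 1 * |siteMean β K ω j| :=
                mul_le_mul_of_nonneg_right (h4.trans hsp) (abs_nonneg _)
            _ ≤ _ := by rw [one_mul]; exact h5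
        have h7 := le_abs_self ((g (totalSpin ω) - g (otherSpin ω j)) * siteMean β K ω j)
        rw [mul_ite, mul_one, mul_zero, mul_sub]
        linarith
    refine le_trans ?_ h2
    rw [integral_gibbs_sub, integral_div, integral_const_mul, integral_gibbs_add,
      integral_gibbs_const, integral_spin_sq_mul β K j fun s => if |s - y| ≤ 3 then 1 else 0]
    have h8 : v * P ≤ ∫ ω : Config n, condSq (siteWeight β K n)
        (2 * β * K * (otherSpin ω j / n)) * (if |otherSpin ω j - y| ≤ 3 then 1 else 0)
        ∂(gibbs β K n) := by
      rw [hP, ← integral_const_mul]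
      refine integral_gibbs_mono β K fun ω => ?_
      have h9 := sb.le_sq ω j
      rw [siteSq] at h9
      by_cases h10 : |totalSpin ω - y| ≤ 2
      · have h11 : |otherSpin ω j - y| ≤ 3 := by
          have e : otherSpin ω j - y = (totalSpin ω - y) - spin ω j := by rw [otherSpin]; ring
          rw [e]
          exact (abs_sub _ _).trans (by linarith [abs_spin_le_one ω j])
        simpa [h10, h11] using h9
      · simp only [h10, if_false, mul_zero]
        refine mul_nonneg (hv.le.trans h9) ?_
        split_ifs <;> norm_num
    have h12 : C * (2 + m) / r ≤ C * (2 + M) / r := by gcongr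
    linarith
  have hsum : n * (v * P - C * (2 + M) / r) ≤
      ∑ j : Fin n, ∫ ω, (g (totalSpin ω) - g (otherSpin ω j)) * (spin ω j - siteMean β K ω j)
        ∂(gibbs β K n) := by
    have := Finset.sum_le_sum fun (j : Fin n) (_ : j ∈ Finset.univ) => hlow j
    rwa [Finset.sum_const, Finset.card_univ, Fintype.card_fin, nsmul_eq_mul] at this
  have hup : ∫ ω : Config n, g (totalSpin ω) * (totalSpin ω - ∑ j, siteMean β K ω j)
      ∂(gibbs β K n) ≤ 4 * (r * a + C) * (1 + M) := by
    refine (le_abs_self _).trans ((abs_integral_gibbs_le β K (χ := fun ω =>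
      4 * (r * a + C) * (1 + scaledSpin k r ω ^ (2 * k))) fun ω => ?_).trans ?_)
    · have h2 := sb.scaled_force_sub_le hs ω
      have h3 := abs_pow_le_one_add (k := k) (m := 2 * k - 1) (by omega) (scaledSpin k r ω)
      set T := totalSpin ω - ∑ j, siteMean β K ω j
      set w := scaledSpin k r ω
      have h4 : |r * a * w ^ (2 * k - 1)| ≤ r * a * (1 + w ^ (2 * k)) := by
        rw [abs_mul, abs_pow, abs_of_pos (by positivity : 0 < r * a)]
        gcongr
      have h5 := abs_sub_abs_le_abs_sub T (r * a * w ^ (2 * k - 1))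
      have h6 : |T| ≤ (r * a + C) * (1 + w ^ (2 * k)) := by linarith
      have h7 : |g (totalSpin ω)| ≤ 4 := by
        rw [abs_le]
        exact ⟨le_max_left _ _, max_le (by norm_num) (min_le_right _ _)⟩
      rw [abs_mul, mul_assoc]
      gcongr
    · rw [integral_const_mul, integral_gibbs_add, integral_gibbs_const]
      gcongr
  rw [← h1] at hsum
  have h2 := hsum.trans hup
  have h3 : 4 * (r * a + C) * (1 + M) ≤ n * (4 * (a + C) * (1 + M) / r) := by
    rw [mul_div_assoc', le_div_iff₀ hr]
    have h4 := hs.sq_le sb.one_le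
    have h5 : r * C ≤ r * r * C := by
      rw [mul_assoc]
      exact le_mul_of_one_le_left (by positivity) hs.one_le_r
    calc 4 * (r * a + C) * (1 + M) * r = 4 * (r * r * a + r * C) * (1 + M) := by ring
      _ ≤ 4 * (r * r * a + r * r * C) * (1 + M) := by gcongr
      _ = r * r * (4 * (a + C) * (1 + M)) := by ring
      _ ≤ _ := by gcongr
  have h4 := le_of_mul_le_mul_left (h2.trans h3) hn
  rw [div_div, mul_comm v r, ← div_div, le_div_iff₀ hv, add_div]
  linarith

end Estimates


/-! ### The approximate Stein identity and the Kolmogorov bound. -/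

section Main

variable {β K : ℝ} {k : ℕ} {v a a' C : ℝ}

/-- The single-site terms in the Stein argument. -/
lemma SiteBounds.site_term_le (sb : SiteBounds β K k v a a' C) {n : ℕ} {r : ℝ}
    (hs : IsScale k n r) {z D : ℝ} {f f' : ℝ → ℝ} (hD : 0 ≤ D) (hf' : ∀ w, |f' w| ≤ 2)
    (hf1 : ∀ w u, |u| ≤ 1 → |f (w + u) - f w - u * f' w| ≤
      |u| * (D * |u| * (1 + w ^ (2 * k)) + if |w - z| ≤ |u| then 4 else 0))
    (hf2 : ∀ w u, |u| ≤ 1 → |f' (w + u) - f' w| ≤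
      D * |u| * (1 + w ^ (2 * k)) + if |w - z| ≤ |u| then 4 else 0) (j : Fin n) :
    |∫ ω : Config n, (f (totalSpin ω / r ^ (2 * k - 1)) - f (otherSpin ω j / r ^ (2 * k - 1))) *
        (spin ω j - siteMean β K ω j) ∂(gibbs β K n) -
      v / r ^ (2 * k - 1) * ∫ ω : Config n, f' (scaledSpin k r ω) ∂(gibbs β K n)| ≤
    1 / r ^ (2 * k - 1) * ∫ ω : Config n, ((4 * 4 ^ k * D + 2 * C + v * D) *
      (2 + scaledSpin k r ω ^ (2 * k)) / r + (8 + 4 * v) *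
        if |totalSpin ω - z * r ^ (2 * k - 1)| ≤ 2 then 1 else 0) ∂(gibbs β K n) := by
  have hv := sb.v_pos
  have hC := sb.C_nonneg
  have hr := hs.r_pos
  set R := r ^ (2 * k - 1) with hR
  have hR1 : 1 ≤ R := one_le_pow₀ hs.one_le_r
  have hR0 : 0 < R := by linarith
  have hrR : r ≤ R := hs.le_pow sb.one_le
  have hw : ∀ ω : Config n, scaledSpin k r ω = otherSpin ω j / R + spin ω j / R := by
    intro ω; rw [scaledSpin, otherSpin]; ring
  have hu : ∀ ω : Config n, |spin ω j / R| ≤ 1 / R := by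
    intro ω; rw [abs_div, abs_of_pos hR0]
    exact div_le_div_of_nonneg_right (abs_spin_le_one ω j) hR0.le
  have hR2 : 1 / R ≤ 1 := (div_le_one hR0).2 hR1
  have hRr : 1 / R ≤ 1 / r := one_div_le_one_div_of_le hr hrR
  set ind : Config n → ℝ := fun ω => if |totalSpin ω - z * R| ≤ 2 then 1 else 0 with hind
  -- The points `S/R` and `w`, and `w` and `z`, are each within `1/R`; after multiplying by `R` the
  -- jump can matter only if `S` is within `2` of `z R`.
  have hind_of : ∀ (ω : Config n) (w : ℝ), |totalSpin ω / R - w| ≤ 1 / R →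
      ∀ u : ℝ, |u| ≤ 1 / R → (if |w - z| ≤ |u| then (4 : ℝ) else 0) ≤ 4 * ind ω := by
    intro ω w hwR u hu
    split_ifs with h
    · have h1 : |totalSpin ω - z * R| ≤ 2 := by
        have e : totalSpin ω - z * R = ((totalSpin ω / R - w) + (w - z)) * R := by
          field_simp; ring
        rw [e, abs_mul, abs_of_pos hR0, ← le_div_iff₀ hR0]
        refine (abs_add_le _ _).trans ?_
        have : (2 : ℝ) / R = 1 / R + 1 / R := by ring
        linarith
      simp [hind, h1]
    · simp only [hind]; split_ifs <;> norm_num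
  have hpow : ∀ ω : Config n, 1 + (otherSpin ω j / R) ^ (2 * k) ≤
      2 * 4 ^ k * (1 + scaledSpin k r ω ^ (2 * k)) := by
    intro ω
    have h1 : |otherSpin ω j / R| ≤ 1 + |scaledSpin k r ω| := by
      have e : otherSpin ω j / R = scaledSpin k r ω - spin ω j / R := by rw [hw ω]; ring
      rw [e]
      exact (abs_sub _ _).trans (by linarith [hu ω])
    have h2 := pow_le_pow_left₀ (abs_nonneg _) h1 (2 * k)
    rw [(even_two_mul k).pow_abs] at h2
    have h3 := one_add_abs_pow_le (le_refl (2 * k)) (scaledSpin k r ω)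
    have h4 : 1 ≤ 4 ^ k * (1 + scaledSpin k r ω ^ (2 * k)) := by
      have h5 : 0 ≤ scaledSpin k r ω ^ (2 * k) := (even_two_mul k).pow_nonneg _
      have h6 : (1 : ℝ) ≤ 4 ^ k := one_le_pow₀ (by norm_num)
      nlinarith
    linarith
  -- The expansion is made around `S_j / R`, not `W`: the derivative then depends only on the other
  -- spins and the conditional variance identity applies.
  have hA : |∫ ω : Config n, (f (totalSpin ω / R) - f (otherSpin ω j / R)) *
      (spin ω j - siteMean β K ω j) ∂(gibbs β K n) -
      ∫ ω : Config n, (spin ω j * (spin ω j - siteMean β K ω j) * (f' (otherSpin ω j / R) / R))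
        ∂(gibbs β K n)| ≤ ∫ ω : Config n, (1 / R) * (4 * 4 ^ k * D *
          (2 + scaledSpin k r ω ^ (2 * k)) / r + 8 * ind ω) ∂(gibbs β K n) := by
    refine abs_integral_gibbs_sub_le β K fun ω => ?_
    have h1 := hf1 (otherSpin ω j / R) (spin ω j / R) ((hu ω).trans hR2)
    rw [← hw ω] at h1
    have h2 := hind_of ω (otherSpin ω j / R)
      (by
        have e : totalSpin ω / R - otherSpin ω j / R = spin ω j / R := by rw [otherSpin]; ring
        rw [e]; exact hu ω) (spin ω j / R) (hu ω)
    have h3 := hpow ω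
    have h4 := abs_spin_sub_siteMean_le sb ω j
    have hsc : totalSpin ω / R = scaledSpin k r ω := rfl
    set w := scaledSpin k r ω
    set w' := otherSpin ω j / R
    have hw0 : 0 ≤ w ^ (2 * k) := (even_two_mul k).pow_nonneg _
    have hw0' : 0 ≤ w' ^ (2 * k) := (even_two_mul k).pow_nonneg _
    have e : (f (totalSpin ω / R) - f w') * (spin ω j - siteMean β K ω j) -
        spin ω j * (spin ω j - siteMean β K ω j) * (f' w' / R) =
        (f w - f w' - spin ω j / R * f' w') * (spin ω j - siteMean β K ω j) := by
      rw [hsc]; ring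
    have hi0 : 0 ≤ ind ω := by simp only [hind]; split_ifs <;> norm_num
    have h5 : D * |spin ω j / R| * (1 + w' ^ (2 * k)) ≤
        D * (1 / r) * (2 * 4 ^ k * (1 + w ^ (2 * k))) := by
      have := (hu ω).trans hRr
      gcongr
    have h6 : |f w - f w' - spin ω j / R * f' w'| ≤
        (1 / R) * (D * (1 / r) * (2 * 4 ^ k * (2 + w ^ (2 * k))) + 4 * ind ω) := by
      refine h1.trans (mul_le_mul (hu ω) (add_le_add (h5.trans ?_) h2) ?_ (by positivity))
      · gcongr; linarith
      · split_ifs <;> positivity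
    rw [e, abs_mul]
    calc _ ≤ (1 / R) * (D * (1 / r) * (2 * 4 ^ k * (2 + w ^ (2 * k))) + 4 * ind ω) * 2 := by
          gcongr
      _ = _ := by ring
  -- Conditioning turns `ω_j (ω_j - m_j)` into the conditional variance. It is then replaced by `v`,
  -- and `S_j / R` by `W` inside `f'`.
  have hB : |∫ ω : Config n, (spin ω j * (spin ω j - siteMean β K ω j) *
        (f' (otherSpin ω j / R) / R)) ∂(gibbs β K n) -
      ∫ ω : Config n, v / R * f' (scaledSpin k r ω) ∂(gibbs β K n)| ≤
      ∫ ω : Config n, (1 / R) * ((2 * C + v * D) * (2 + scaledSpin k r ω ^ (2 * k)) / r +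
        4 * v * ind ω) ∂(gibbs β K n) := by
    rw [integral_spin_mul_spin_sub_mul β K j fun s => f' (s / R) / R]
    refine abs_integral_gibbs_sub_le β K fun ω => ?_
    have hu' : |-(spin ω j / R)| ≤ 1 / R := by rw [abs_neg]; exact hu ω
    have h1 := hf2 (scaledSpin k r ω) (-(spin ω j / R)) (hu'.trans hR2)
    have e0 : scaledSpin k r ω + -(spin ω j / R) = otherSpin ω j / R := by rw [hw ω]; ring
    rw [e0] at h1
    have h2 := hind_of ω (scaledSpin k r ω) (by
      have : totalSpin ω / R - scaledSpin k r ω = 0 := sub_self _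
      rw [this, abs_zero]; positivity) (-(spin ω j / R)) hu'
    have h3 := sb.scaled_var_sub_le hs ω j
    have h4 := hf' (otherSpin ω j / R)
    set w := scaledSpin k r ω
    set w' := otherSpin ω j / R
    set s := siteSq β K ω j - siteMean β K ω j ^ 2
    have hw0 : 0 ≤ w ^ (2 * k) := (even_two_mul k).pow_nonneg _
    have e : s * (f' w' / R) - v / R * f' w = (1 / R) * ((s - v) * f' w' + v * (f' w' - f' w)) := by
      ring
    have h5 : D * |-(spin ω j / R)| * (1 + w ^ (2 * k)) ≤ D * (1 / r) * (2 + w ^ (2 * k)) := by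
      have := hu'.trans hRr
      gcongr
      norm_num
    have h6 : |f' w' - f' w| ≤ D * (1 / r) * (2 + w ^ (2 * k)) + 4 * ind ω := by linarith
    rw [e, abs_mul, abs_of_pos (by positivity : 0 < 1 / R)]
    refine mul_le_mul_of_nonneg_left ?_ (by positivity)
    refine (abs_add_le _ _).trans ?_
    rw [abs_mul, abs_mul, abs_of_pos hv]
    calc _ ≤ (C * (2 + w ^ (2 * k)) / r) * 2 +
          v * (D * (1 / r) * (2 + w ^ (2 * k)) + 4 * ind ω) := by gcongr
      _ = _ := by ring
  rw [integral_const_mul] at hA hB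
  have hAB := (abs_sub_le _ _ _).trans (add_le_add hA hB)
  rw [integral_const_mul, ← mul_add, ← integral_gibbs_add] at hAB
  refine hAB.trans_eq ?_
  congr 2
  funext ω
  ring

/-- The approximate Stein identity. -/
lemma SiteBounds.exists_stein_identity (sb : SiteBounds β K k v a a' C) {D : ℝ} (hD : 0 ≤ D) :
    ∃ C₆ : ℝ, 0 ≤ C₆ ∧ ∀ (n : ℕ) (r : ℝ), IsScale k n r → ∀ (z : ℝ) (f f' : ℝ → ℝ),
      (∀ w, |f w| ≤ D) → (∀ w, |f' w| ≤ 2) →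
      (∀ w u, |u| ≤ 1 → |f (w + u) - f w - u * f' w| ≤
        |u| * (D * |u| * (1 + w ^ (2 * k)) + if |w - z| ≤ |u| then 4 else 0)) →
      (∀ w u, |u| ≤ 1 → |f' (w + u) - f' w| ≤
        D * |u| * (1 + w ^ (2 * k)) + if |w - z| ≤ |u| then 4 else 0) →
      |v * ∫ ω : Config n, f' (scaledSpin k r ω) ∂(gibbs β K n) -
        a * ∫ ω : Config n, scaledSpin k r ω ^ (2 * k - 1) * f (scaledSpin k r ω)
          ∂(gibbs β K n)| ≤ C₆ / r := by
  obtain ⟨C₄, hC₄, hconc⟩ := sb.exists_concentration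
  have ha' := sb.a'_pos
  have hv := sb.v_pos
  have hC := sb.C_nonneg
  set M := (2 + C) / a' with hM
  set B := (4 * 4 ^ k * D + 2 * C + v * D) * (2 + M) + (8 + 4 * v) * C₄ with hB
  refine ⟨B + D * C * (1 + M), by positivity, fun n r hs z f f' hf hf' hf1 hf2 => ?_⟩
  have hn := hs.n_pos
  have hr := hs.r_pos
  have hm := sb.moment_le hs
  have h1 := integral_mul_totalSpin_sub (n := n) β K fun s => f (s / r ^ (2 * k - 1))
  have h2 := sb.site_term_le hs hD hf' hf1 hf2
  set R := r ^ (2 * k - 1) with hR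
  have hR0 : 0 < R := by positivity
  set E := ∫ ω : Config n, f' (scaledSpin k r ω) ∂(gibbs β K n)
  have h3 : ∀ j : Fin n, |∫ ω : Config n, (f (totalSpin ω / R) - f (otherSpin ω j / R)) *
        (spin ω j - siteMean β K ω j) ∂(gibbs β K n) - v / R * E| ≤ 1 / R * (B / r) := by
    intro j
    refine (h2 j).trans (mul_le_mul_of_nonneg_left ?_ (by positivity))
    rw [integral_gibbs_add, integral_div, integral_const_mul, integral_const_mul,
      integral_gibbs_add, integral_gibbs_const, hB, add_div]
    have h4 := hconc n r hs (z * R)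
    refine add_le_add (by gcongr) ?_
    rw [mul_div_assoc]
    gcongr
  have h4 : |∑ j : Fin n, (∫ ω : Config n, (f (totalSpin ω / R) - f (otherSpin ω j / R)) *
        (spin ω j - siteMean β K ω j) ∂(gibbs β K n) - v / R * E)| ≤ n * (1 / R * (B / r)) :=
    abs_sum_le_card_mul h3
  rw [Finset.sum_sub_distrib, ← h1, Finset.sum_const, Finset.card_univ, Fintype.card_fin,
    nsmul_eq_mul] at h4
  -- Because `n = r R`, the `n` site terms of size `1/R` add up to order `r`, and their errors, of
  -- size `1/(R r)`, to order `1`. Dividing by `r` at the end gives the rate.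
  have e1 : n * (v / R * E) = r * (v * E) := by
    rw [hs.eq_mul sb.one_le, ← hR]; field_simp
  have e2 : n * (1 / R * (B / r)) = B := by
    rw [hs.eq_mul sb.one_le, ← hR]; field_simp
  rw [e1, e2] at h4
  have h5 : |∫ ω : Config n, f (totalSpin ω / R) * (totalSpin ω - ∑ j, siteMean β K ω j)
      ∂(gibbs β K n) - ∫ ω : Config n, r * (a * (scaledSpin k r ω ^ (2 * k - 1) *
        f (scaledSpin k r ω))) ∂(gibbs β K n)| ≤ D * C * (1 + M) := by
    refine (abs_integral_gibbs_sub_le β K (χ := fun ω =>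
      D * (C * (1 + scaledSpin k r ω ^ (2 * k)))) fun ω => ?_).trans ?_
    · have h6 := sb.scaled_force_sub_le hs ω
      have hsc : totalSpin ω / R = scaledSpin k r ω := rfl
      rw [hsc]
      have e3 : f (scaledSpin k r ω) * (totalSpin ω - ∑ j, siteMean β K ω j) -
          r * (a * (scaledSpin k r ω ^ (2 * k - 1) * f (scaledSpin k r ω))) =
          f (scaledSpin k r ω) * (totalSpin ω - ∑ j, siteMean β K ω j -
            r * a * scaledSpin k r ω ^ (2 * k - 1)) := by ring
      rw [e3, abs_mul]
      exact mul_le_mul (hf _) h6 (abs_nonneg _) hD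
    · rw [integral_const_mul, integral_const_mul, integral_gibbs_add, integral_gibbs_const,
        ← mul_assoc]
      gcongr
  rw [integral_const_mul, integral_const_mul] at h5
  rw [le_div_iff₀ hr, ← abs_of_pos hr, ← abs_mul, abs_of_pos hr, sub_mul, mul_comm _ r,
    mul_comm _ r]
  rw [abs_sub_comm] at h4
  have := (abs_sub_le _ _ _).trans (add_le_add h4 h5)
  exact this

lemma lawW_real_Iic (β K γ : ℝ) (n : ℕ) (t : ℝ) : (lawW β K γ n).real (Iic t) =
    ∫ ω : Config n, (if W γ ω ≤ t then 1 else 0) ∂(gibbs β K n) := by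
  rw [lawW, map_measureReal_apply (measurable_of_finite _) measurableSet_Iic,
    ← integral_indicator_one (measurable_of_finite _ measurableSet_Iic)]
  rfl

lemma isScale_rpow {k n : ℕ} (hk : 1 ≤ k) (hn : 1 ≤ n) {γ : ℝ} (hγ : γ * (2 * k) = 1) :
    IsScale k n ((n : ℝ) ^ γ) := by
  have hn1 : (1 : ℝ) ≤ n := by exact_mod_cast hn
  have hk1 : (1 : ℝ) ≤ k := by exact_mod_cast hk
  refine ⟨hn, Real.one_le_rpow hn1 (by nlinarith), ?_⟩
  rw [← Real.rpow_natCast, ← Real.rpow_mul (by linarith)]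
  push_cast
  rw [hγ, Real.rpow_one]

lemma W_eq_scaledSpin {k n : ℕ} (hk : 1 ≤ k) {γ : ℝ} (hγ : γ * (2 * k) = 1) (ω : Config n) :
    W γ ω = scaledSpin k ((n : ℝ) ^ γ) ω := by
  rw [W, scaledSpin, ← Real.rpow_natCast, ← Real.rpow_mul (Nat.cast_nonneg n)]
  congr 2
  rw [Nat.cast_sub (by omega)]
  push_cast
  linear_combination -hγ

lemma kolmogorovDist_le_one (μ ν : Measure ℝ) [IsProbabilityMeasure μ]
    [IsProbabilityMeasure ν] : kolmogorovDist μ ν ≤ 1 := by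
  refine ciSup_le fun t => ?_
  have h1 : μ.real (Iic t) ≤ 1 := measureReal_le_one
  have h2 : ν.real (Iic t) ≤ 1 := measureReal_le_one
  have h3 : 0 ≤ μ.real (Iic t) := measureReal_nonneg
  have h4 : 0 ≤ ν.real (Iic t) := measureReal_nonneg
  rw [abs_le]
  constructor <;> linarith

/-- The Kolmogorov bound in terms of the order of degeneracy `k`, with `γ = 1/(2k)`. -/
theorem SiteBounds.exists_kolmogorovDist_le (sb : SiteBounds β K k v a a' C) {γ : ℝ}
    (hγ : γ * (2 * k) = 1) : ∃ L : ℝ, ∀ n : ℕ, 1 ≤ n →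
      kolmogorovDist (lawW β K γ n)
        (expPowLaw (2 * k * momentW β K γ n (2 * k))⁻¹ (2 * k)) ≤ L * (n : ℝ) ^ (-γ) := by
  have hk := sb.one_le
  have ha := sb.a_pos
  have ha' := sb.a'_pos
  have hv := sb.v_pos
  have hC := sb.C_nonneg
  have hk0 : (0 : ℝ) < k := by exact_mod_cast hk
  obtain ⟨C₃, hC₃, hmom⟩ := sb.exists_moment_sub_le
  set M := (2 + C) / a' with hM
  have hM0 : 0 < M := by positivity
  -- The coefficient is `(2 k m)⁻¹` with `m` the `2k`-th moment; `c₀` comes from `m ≤ M`, and `c₁`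
  -- from `m ≥ v / (2a)`, which holds once `C₃ / r < v / 2`.
  obtain ⟨D, hD, hstein⟩ := exists_stein_solution (k := k) (by omega)
    (c₀ := (2 * k * M)⁻¹) (c₁ := (2 * k * (v / (2 * a)))⁻¹) (by positivity)
  obtain ⟨C₆, hC₆, hident⟩ := sb.exists_stein_identity hD
  refine ⟨2 * C₃ / v + (C₆ + C₃ * (2 * a / v) * (D * (1 + M))) / v, fun n hn => ?_⟩
  have hs := isScale_rpow hk hn hγ
  have hW : ∀ ω : Config n, W γ ω = scaledSpin k ((n : ℝ) ^ γ) ω := W_eq_scaledSpin hk hγ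
  rw [Real.rpow_neg (Nat.cast_nonneg n), ← div_eq_mul_inv]
  set r := (n : ℝ) ^ γ with hr
  have hr0 := hs.r_pos
  have hmpos := momentW_pos β K γ hn (even_two_mul k)
  have hmle := sb.moment_le hs
  have hmm := hmom n r hs
  have hmW : momentW β K γ n (2 * k) =
      ∫ ω : Config n, scaledSpin k r ω ^ (2 * k) ∂(gibbs β K n) := by
    simp only [momentW, hW]
  rw [← hmW] at hmle hmm
  set m := momentW β K γ n (2 * k)
  rw [add_div]
  have hprob : IsProbabilityMeasure (expPowLaw (2 * k * m)⁻¹ (2 * k)) :=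
    isProbabilityMeasure_expPowLaw (by positivity) (even_two_mul k) (by omega)
  -- When `r` is too small for the lower bound on the moment, the first summand of the constant
  -- already exceeds the trivial bound `1` on the distance.
  rcases le_or_gt (v / 2) (C₃ / r) with hbad | hgood
  · refine (kolmogorovDist_le_one _ _).trans ?_
    have h1 : 1 ≤ 2 * C₃ / v / r := by
      rw [div_div, mul_comm v r, ← div_div, le_div_iff₀ hv, mul_div_assoc]
      linarith
    have h2 : 0 ≤ (C₆ + C₃ * (2 * a / v) * (D * (1 + M))) / v / r := by positivity
    linarith
  · have hmlow : v / (2 * a) ≤ m := by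
      rw [div_le_iff₀ (by positivity)]
      have := (abs_le.1 hmm).1
      linarith
    refine ciSup_le fun z => ?_
    obtain ⟨f, f', hf, hf', heq, hf1, hf2⟩ := hstein (2 * k * m)⁻¹ (by gcongr) (by gcongr) z
    have h1 := hident n r hs z f f' hf hf' hf1 hf2
    set E := ∫ ω : Config n, f' (scaledSpin k r ω) ∂(gibbs β K n)
    set Q := ∫ ω : Config n, scaledSpin k r ω ^ (2 * k - 1) * f (scaledSpin k r ω)
          ∂(gibbs β K n)
    have h2 : (lawW β K γ n).real (Iic z) - (expPowLaw (2 * k * m)⁻¹ (2 * k)).real (Iic z) =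
        E - m⁻¹ * Q := by
      rw [lawW_real_Iic]
      simp only [hW]
      rw [← integral_gibbs_const (n := n) β K ((expPowLaw (2 * k * m)⁻¹ (2 * k)).real (Iic z)),
        ← integral_gibbs_sub, ← integral_const_mul, ← integral_gibbs_sub]
      congr 1
      funext ω
      rw [← heq]
      field_simp
    have hQ : |Q| ≤ D * (1 + M) := by
      refine (abs_integral_gibbs_le β K (χ := fun ω =>
        D * (1 + scaledSpin k r ω ^ (2 * k))) fun ω => ?_).trans ?_
      · rw [abs_mul, mul_comm, abs_pow]
        exact mul_le_mul (hf _) (abs_pow_le_one_add (by omega) _) (by positivity) hD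
      · rw [integral_const_mul, integral_gibbs_add, integral_gibbs_const, ← hmW]
        gcongr
    -- The first term is the Stein identity with coefficient `a / v`, the second the error of
    -- replacing `a / v` by `1 / m`, controlled by the rate at which `a m` approaches `v`.
    have h3 : v * (E - m⁻¹ * Q) = (v * E - a * Q) + (a * m - v) * m⁻¹ * Q := by
      field_simp; ring
    have h4 : m⁻¹ ≤ 2 * a / v := by
      rw [← inv_div]
      gcongr
    have h5 : |(a * m - v) * m⁻¹ * Q| ≤ C₃ / r * (2 * a / v) * (D * (1 + M)) := by
      rw [abs_mul, abs_mul, abs_of_pos (inv_pos.2 hmpos)]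
      gcongr
    have h6 : v * |E - m⁻¹ * Q| ≤ C₆ / r + C₃ / r * (2 * a / v) * (D * (1 + M)) := by
      rw [← abs_of_pos hv, ← abs_mul, abs_of_pos hv, h3]
      exact (abs_add_le _ _).trans (add_le_add h1 h5)
    rw [h2]
    have h7 : |E - m⁻¹ * Q| ≤ (C₆ + C₃ * (2 * a / v) * (D * (1 + M))) / v / r := by
      rw [div_div, mul_comm v r, ← div_div, le_div_iff₀ hv, mul_comm]
      refine h6.trans_eq ?_
      ring
    have h8 : 0 ≤ 2 * C₃ / v / r := by positivity
    linarith

end Main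

/-! ### Order of degeneracy in the three regimes. -/

/-- The zeroth coefficient `1 + 2A(1 - b)` is positive exactly when `b < 1 + e^β / 2`, that is `K <
critK β`. As `e^β ≤ 4`, this forces `b < 3`, so the factors `2j + 1 - b` with `j ≥ 1` are positive
too. -/
lemma isCriticalOrder_of_mem_regionA {β K : ℝ} (h : (β, K) ∈ regionA) :
    IsCriticalOrder (Real.exp (-β)) (2 * β * K) 1 := by
  obtain ⟨hβ, hβc, hK, hKc⟩ := h
  simp only [betaC, critK] at hβ hβc hK hKc
  have hA := Real.exp_pos (-β)
  have he : Real.exp β ≤ 4 := by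
    rw [← Real.exp_log (by norm_num : (0 : ℝ) < 4)]; exact Real.exp_le_exp.2 hβc
  have hAe : Real.exp (-β) * Real.exp β = 1 := by rw [← Real.exp_add]; simp
  have hb : 2 * β * K < (Real.exp β + 2) / 2 := by
    rw [lt_div_iff₀ (by positivity)] at hKc
    linarith
  have hb0 : 0 < 2 * β * K := by positivity
  refine ⟨le_rfl, fun j hj => absurd hj (by simp), ?_, fun j hj => ?_⟩
  · simp only [responseCoeff]
    norm_num
    nlinarith
  · have hj1 : (1 : ℝ) ≤ j := by exact_mod_cast hj
    rw [responseCoeff, if_neg (by omega)]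
    have : 0 ≤ 2 * (j : ℝ) + 1 - 2 * β * K := by linarith
    positivity

lemma two_mul_mul_critK {β : ℝ} (hβ : 0 < β) : 2 * β * critK β = (Real.exp β + 2) / 2 := by
  rw [critK]; field_simp; ring

lemma critK_pos {β : ℝ} (hβ : 0 < β) : 0 < critK β := by
  rw [critK]; positivity

/-- On the critical curve `b = 1 + e^β / 2` kills the zeroth coefficient, and `e^β < 4` keeps `3 -
b` strictly positive. -/
lemma isCriticalOrder_of_lt_betaC {β : ℝ} (hβ : 0 < β) (hβc : β < betaC) :
    IsCriticalOrder (Real.exp (-β)) (2 * β * critK β) 2 := by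
  rw [two_mul_mul_critK hβ]
  have hA := Real.exp_pos (-β)
  have he0 := Real.exp_pos β
  have he : Real.exp β < 4 := by
    rw [← Real.exp_log (by norm_num : (0 : ℝ) < 4)]; exact Real.exp_lt_exp.2 hβc
  have hAe : Real.exp (-β) * Real.exp β = 1 := by rw [← Real.exp_add]; simp
  refine ⟨by norm_num, fun j hj => ?_, ?_, fun j hj => ?_⟩
  · obtain rfl : j = 0 := by omega
    simp only [responseCoeff]
    norm_num
    linear_combination -hAe
  · have : 0 < 2 * ((2 - 1 : ℕ) : ℝ) + 1 - (Real.exp β + 2) / 2 := by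
      norm_num
      linarith
    rw [responseCoeff, if_neg (by norm_num)]
    positivity
  · have hj1 : (2 : ℝ) ≤ j := by exact_mod_cast hj
    rw [responseCoeff, if_neg (by omega)]
    have : 0 ≤ 2 * (j : ℝ) + 1 - (Real.exp β + 2) / 2 := by linarith
    positivity

lemma betaC_pos : 0 < betaC := Real.log_pos (by norm_num)

/-- At `e^β = 4` one has `b = 3`, so the cubic coefficient vanishes as well and the quintic one,
with factor `5 - 3`, takes over. -/
lemma isCriticalOrder_betaC :
    IsCriticalOrder (Real.exp (-betaC)) (2 * betaC * critK betaC) 3 := by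
  rw [two_mul_mul_critK betaC_pos]
  have he : Real.exp betaC = 4 := Real.exp_log (by norm_num)
  have hA : Real.exp (-betaC) = 1 / 4 := by rw [Real.exp_neg, he]; norm_num
  rw [hA, he]
  refine ⟨by norm_num, fun j hj => ?_, ?_, fun j hj => ?_⟩
  · have hj' : j < 2 := by omega
    interval_cases j <;> norm_num [responseCoeff]
  · norm_num [responseCoeff, Nat.factorial]
  · have hj1 : (3 : ℝ) ≤ j := by exact_mod_cast hj
    rw [responseCoeff, if_neg (by omega)]
    have : 0 ≤ 2 * (j : ℝ) + 1 - (4 + 2) / 2 := by linarith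
    positivity

lemma gaussianReal_eq_expPowLaw {v : ℝ} (hv : 0 < v) :
    gaussianReal 0 v.toNNReal = expPowLaw (2 * v)⁻¹ 2 := by
  have hv' : v.toNNReal ≠ 0 := by simpa using hv
  rw [gaussianReal_of_var_ne_zero _ hv', expPowLaw, Measure.tilted]
  congr 1
  funext x
  have e1 : Real.pi / (2 * v)⁻¹ = 2 * Real.pi * v := by field_simp
  have e2 : -(2 * v)⁻¹ * x ^ 2 = -(x - 0) ^ 2 / (2 * v) := by field_simp; ring
  rw [gaussianPDF, gaussianPDFReal, integral_gaussian, Real.coe_toNNReal _ hv.le, e1, e2,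
    div_eq_inv_mul (Real.exp _)]

end BEG

open BEG
theorem theorem2p1 :
    -- (1) single-phase region, γ = 1/2, normal limit
    (∀ β K : ℝ, (β, K) ∈ regionA → ∃ L : ℝ, ∀ n : ℕ, 1 ≤ n →
      kolmogorovDist (lawW β K (1 / 2) n)
        (gaussianReal 0 (momentW β K (1 / 2) n 2).toNNReal) ≤ L * (n : ℝ) ^ (-(1 / 2) : ℝ)) ∧
    -- (2) second-order curve, γ = 1/4, density ∝ exp(-t⁴ / (4 E W⁴))
    (∀ β K : ℝ, (β, K) ∈ curveB → ∃ L : ℝ, ∀ n : ℕ, 1 ≤ n →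
      kolmogorovDist (lawW β K (1 / 4) n)
        (expPowLaw (4 * momentW β K (1 / 4) n 4)⁻¹ 4) ≤ L * (n : ℝ) ^ (-(1 / 4) : ℝ)) ∧
    -- (3) tricritical point, γ = 1/6, density ∝ exp(-t⁶ / (6 E W⁶))
    (∃ L : ℝ, ∀ n : ℕ, 1 ≤ n →
      kolmogorovDist (lawW betaC (critK betaC) (1 / 6) n)
        (expPowLaw (6 * momentW betaC (critK betaC) (1 / 6) n 6)⁻¹ 6) ≤
          L * (n : ℝ) ^ (-(1 / 6) : ℝ)) := by
  refine ⟨fun β K h => ?_, fun β K h => ?_, ?_⟩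
  · obtain ⟨v, a, a', C, sb⟩ := exists_siteBounds h.1 h.2.2.1 (isCriticalOrder_of_mem_regionA h)
    obtain ⟨L, hL⟩ := sb.exists_kolmogorovDist_le (γ := 1 / 2) (by norm_num)
    refine ⟨L, fun n hn => ?_⟩
    rw [gaussianReal_eq_expPowLaw (momentW_pos β K (1 / 2) hn even_two)]
    simpa using hL n hn
  · obtain ⟨hβ, hβc, hK⟩ := h
    simp only at hβ hβc hK
    subst hK
    obtain ⟨v, a, a', C, sb⟩ := exists_siteBounds hβ (critK_pos hβ)
      (isCriticalOrder_of_lt_betaC hβ hβc)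
    obtain ⟨L, hL⟩ := sb.exists_kolmogorovDist_le (γ := 1 / 4) (by norm_num)
    refine ⟨L, fun n hn => ?_⟩
    convert hL n hn using 5
    norm_num
  · obtain ⟨v, a, a', C, sb⟩ := exists_siteBounds betaC_pos (critK_pos betaC_pos)
      isCriticalOrder_betaC
    obtain ⟨L, hL⟩ := sb.exists_kolmogorovDist_le (γ := 1 / 6) (by norm_num)
    refine ⟨L, fun n hn => ?_⟩
    convert hL n hn using 5
    norm_num
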